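/- **Theorem 4.3.** Let $K$ be an infinite field, let $V$ be an $n$-dimensional $K$-vector space and let $E=\bigoplus_{m=0}^{n}\bigwedge^m V$ be its exterior algebra, graded with $V$ in degree $1$. Let $M$ be a finitely generated ($\mathbb Z$-)graded left and right $E$-module with $ax=(-1)^{\deg(a)\deg(x)}xa$ for all homogeneous $a\in E$ and $x\in M$. Write $\beta^E_{i,j}(M)=\dim_K \operatorname{Tor}^E_i(K,M)_j$. For $1\le p\le n$ and $k\ge 0$ let $\alpha_{p,k}(M)$ be the exterior generic annihilator number of $M$, that is, the value that $$\dim_K\Big(\big((v_1,\dots,v_{p-1})M:_M v_p\big)\big/(v_1,\dots,v_p)M\Big)_k$$ takes for generic linear forms $v_1,\dots,v_n\in E_1=V$ (it is constant on a nonempty Zariski-open subset of $V^n$). Suppose that for some $i>1$ and some $k\ge 0$ $$\beta^E_{i,i+k}(M)=\sum_{j=1}^{n}\binom{n-j+i-1}{i-1}\alpha_{j,k}(M).$$ Then, for the same $k$, $$\beta^E_{q,q+k}(M)=\sum_{j=1}^{n}\binom{n-j+q-1}{q-1}\alpha_{j,k}(M)\qquad\text{for all } q\ge 1.$$ -/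

import Mathlib

namespace ExteriorGraded

universe u v w

variable {K : Type u} [Field K] {V : Type v} [AddCommGroup V] [Module K V]

/-- The `ℤ`-grading of the exterior algebra: `⋀ᵐ V` in degree `m ≥ 0`, and `0` in negative
degrees. -/
def extDeg (K : Type u) [Field K] (V : Type v) [AddCommGroup V] [Module K V] (m : ℤ) :
    Submodule K (ExteriorAlgebra K V) :=
  if 0 ≤ m then ⋀[K]^(m.toNat) V else ⊥

/-- With the decomposition `M = ⊕ ℳ d` into `K`-subspaces, the left module `M` over the exterior
algebra `E` of `V` is a `ℤ`-graded `E`-module. -/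
structure IsGraded (V : Type v) [AddCommGroup V] [Module K V] {M : Type w} [AddCommGroup M] [Module K M] [Module (ExteriorAlgebra K V) M]
    (ℳ : ℤ → Submodule K M) : Prop where
  internal : DirectSum.IsInternal ℳ
  smul_mem : ∀ (m d : ℤ) (a : (ExteriorAlgebra K V)) (x : M), a ∈ extDeg K V m → x ∈ ℳ d → a • x ∈ ℳ (m + d)

/-- `M` is an object of the category of finitely generated graded left and right `E`-modules with
`a x = (-1)^{deg a deg x} x a` for homogeneous `a ∈ E` and `x ∈ M`. The right action is the action
of the opposite ring. -/
structure IsInCategoryM (V : Type v) [AddCommGroup V] [Module K V] {M : Type w} [AddCommGroup M]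
    [Module K M] [Module (ExteriorAlgebra K V) M] [Module (ExteriorAlgebra K V)ᵐᵒᵖ M]
    (ℳ : ℤ → Submodule K M) : Prop extends IsGraded V ℳ where
  finite : Module.Finite (ExteriorAlgebra K V) M
  smul_eq : ∀ (m d : ℤ) (a : ExteriorAlgebra K V) (x : M), a ∈ extDeg K V m → x ∈ ℳ d →
    a • x = (m * d).negOnePow • (MulOpposite.op a • x)

/-- The degree `j` component of the free graded module `⊕_b E(-deg b)`. -/
def freeDeg {r : ℕ} (deg : Fin r → ℤ) (j : ℤ) : Submodule K (Fin r → (ExteriorAlgebra K V)) where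
  carrier := {x | ∀ b, x b ∈ extDeg K V (j - deg b)}
  add_mem' hx hy b := add_mem (hx b) (hy b)
  zero_mem' _ := zero_mem _
  smul_mem' c _ hx b := Submodule.smul_mem _ c (hx b)

lemma extDeg_mul {m d : ℤ} {a x : (ExteriorAlgebra K V)} (ha : a ∈ extDeg K V m) (hx : x ∈ extDeg K V d) :
    a * x ∈ extDeg K V (m + d) := by
  unfold extDeg at *
  split_ifs at ha with hm
  · split_ifs at hx with hd
    · rw [if_pos (by omega), Int.toNat_add hm hd]
      exact SetLike.mul_mem_graded ha hx
    · simp [(Submodule.mem_bot K).1 hx]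
  · simp [(Submodule.mem_bot K).1 ha]

lemma extDeg_indep : iSupIndep (extDeg K V) := by
  rw [iSupIndep_iff_finsetSum_eq_zero_imp_eq_zero]
  intro s v hv hs i hi
  have hvi := hv i hi
  unfold extDeg at hvi
  split_ifs at hvi with h0
  · have h := congrArg (fun x => ((DirectSum.decompose (fun n : ℕ => ⋀[K]^n V) x) i.toNat : (ExteriorAlgebra K V))) hs
    simp only [DirectSum.decompose_sum, DirectSum.decompose_zero, DirectSum.sum_apply,
      AddSubmonoidClass.coe_finsetSum, DirectSum.zero_apply, ZeroMemClass.coe_zero] at h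
    rw [Finset.sum_eq_single i] at h
    · rwa [DirectSum.decompose_of_mem_same (fun n : ℕ => ⋀[K]^n V) hvi] at h
    · intro j hj hji
      have hvj := hv j hj
      unfold extDeg at hvj
      split_ifs at hvj with h1
      · exact DirectSum.decompose_of_mem_ne (fun n : ℕ => ⋀[K]^n V) hvj (fun hh => hji (by omega))
      · simp [(Submodule.mem_bot K).1 hvj]
    · exact fun h => absurd hi h
  · exact (Submodule.mem_bot K).1 hvi

lemma extDeg_iSup : iSup (extDeg K V) = ⊤ := by
  rw [eq_top_iff, ← (DirectSum.Decomposition.isInternal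
    (fun n : ℕ => ⋀[K]^n V)).submodule_iSup_eq_top]
  refine iSup_le fun n => ?_
  refine le_trans ?_ (le_iSup _ (n : ℤ))
  simp [extDeg]

lemma freeDeg_isGraded {r : ℕ} (deg : Fin r → ℤ) :
    IsGraded V (freeDeg (K := K) (V := V) deg) where
  internal := by
    refine DirectSum.isInternal_submodule_of_iSupIndep_of_iSup_eq_top ?_ ?_
    · rw [iSupIndep_iff_finsetSum_eq_zero_imp_eq_zero]
      intro s v hv hs i hi
      funext b
      have h := (iSupIndep_iff_finsetSum_eq_zero_imp_eq_zero _).1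
        ((extDeg_indep (K := K) (V := V)).comp (f := fun j : ℤ => j - deg b)
          (fun x y h => by simpa using h))
      refine h s (fun j => v j b) (fun j hj => hv j hj b) ?_ i hi
      simpa using congrFun hs b
    · rw [eq_top_iff]
      rintro x -
      rw [← Finset.univ_sum_single x]
      refine Submodule.sum_mem _ fun b _ => ?_
      have hx : x b ∈ iSup (extDeg K V) := by rw [extDeg_iSup]; trivial
      generalize x b = y at hx
      refine Submodule.iSup_induction (extDeg K V)
        (motive := fun y => (Pi.single b y : Fin r → (ExteriorAlgebra K V)) ∈ iSup (freeDeg deg)) hx ?_ ?_ ?_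
      · intro m y hy
        refine Submodule.mem_iSup_of_mem (m + deg b) fun c => ?_
        by_cases hc : c = b
        · subst hc; simpa using hy
        · simp [Pi.single_eq_of_ne hc]
      · simp
      · intro y z hy hz
        rw [Pi.single_add]
        exact add_mem hy hz
  smul_mem m d a x ha hx b := by
    have := extDeg_mul ha (hx b)
    rwa [← add_sub_assoc] at this

/-- A resolution `⋯ → F₁ → F₀ → M → 0` of the graded `E`-module `M` by graded free `E`-modules
`F_i = ⊕_b E(-deg i b)` of finite rank, with `E`-linear maps of degree zero. -/
structure GradedFreeResolution (V : Type v) [AddCommGroup V] [Module K V] {M : Type w} [AddCommGroup M] [Module K M] [Module (ExteriorAlgebra K V) M]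
    (ℳ : ℤ → Submodule K M) where
  rank : ℕ → ℕ
  deg : ∀ i, Fin (rank i) → ℤ
  ε : (Fin (rank 0) → (ExteriorAlgebra K V)) →ₗ[(ExteriorAlgebra K V)] M
  d : ∀ i, (Fin (rank (i + 1)) → (ExteriorAlgebra K V)) →ₗ[(ExteriorAlgebra K V)] (Fin (rank i) → (ExteriorAlgebra K V))
  ε_mem : ∀ j, ∀ x ∈ freeDeg (K := K) (deg 0) j, ε x ∈ ℳ j
  d_mem : ∀ i j, ∀ x ∈ freeDeg (K := K) (deg (i + 1)) j, d i x ∈ freeDeg (K := K) (deg i) j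
  range_ε : LinearMap.range ε = ⊤
  range_d_zero : LinearMap.range (d 0) = LinearMap.ker ε
  range_d_succ : ∀ i, LinearMap.range (d (i + 1)) = LinearMap.ker (d i)

section
variable {M : Type w} [AddCommGroup M] [Module K M] [Module (ExteriorAlgebra K V) M] {ℳ : ℤ → Submodule K M}

lemma exists_cover (hM : IsGraded V ℳ) (P : Submodule (ExteriorAlgebra K V) M) (hP : P.FG)
    (hom : P ≤ Submodule.span (ExteriorAlgebra K V) {y | y ∈ P ∧ ∃ j, y ∈ ℳ j}) :
    ∃ (r : ℕ) (deg : Fin r → ℤ) (f : (Fin r → (ExteriorAlgebra K V)) →ₗ[(ExteriorAlgebra K V)] M),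
      (∀ j, ∀ x ∈ freeDeg (K := K) deg j, f x ∈ ℳ j) ∧ LinearMap.range f = P := by
  have heq : P = Submodule.span (ExteriorAlgebra K V) {y | y ∈ P ∧ ∃ j, y ∈ ℳ j} :=
    le_antisymm hom (Submodule.span_le.2 fun y hy => hy.1)
  rw [heq] at hP
  obtain ⟨T, hT, hTs⟩ := (Submodule.fg_span_iff_fg_span_finset_subset _).1 hP
  have hdeg : ∀ t : T, ∃ j, (t : M) ∈ ℳ j := fun t => (hT t.2).2
  choose g hg using hdeg
  refine ⟨T.card, fun b => g (T.equivFin.symm b),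
    Fintype.linearCombination (ExteriorAlgebra K V) (fun b => ((T.equivFin.symm b : T) : M)), ?_, ?_⟩
  · intro j x hx
    rw [Fintype.linearCombination_apply]
    refine Submodule.sum_mem _ fun b _ => ?_
    simpa using hM.smul_mem _ _ _ _ (hx b) (hg (T.equivFin.symm b))
  · rw [Fintype.range_linearCombination, heq, hTs]
    congr 1
    ext y
    constructor
    · rintro ⟨b, rfl⟩
      exact (T.equivFin.symm b).2
    · intro hy
      exact ⟨T.equivFin ⟨y, hy⟩, by simp⟩

lemma mem_span_hom (hM : IsGraded V ℳ) (x : M) :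
    ∃ (s : Finset ℤ) (y : ℤ → M), (∀ j, y j ∈ ℳ j) ∧ x = ∑ j ∈ s, y j := by
  have hx : x ∈ iSup ℳ := by rw [hM.internal.submodule_iSup_eq_top]; trivial
  obtain ⟨f, hf, rfl⟩ := (Submodule.mem_iSup_iff_exists_finsupp ..).mp hx
  exact ⟨f.support, f, hf, rfl⟩

lemma ker_hom {N : Type*} [AddCommGroup N] [Module K N] [Module (ExteriorAlgebra K V) N] {𝒩 : ℤ → Submodule K N}
    (hN : IsGraded V 𝒩) (hM : IsGraded V ℳ) (f : N →ₗ[(ExteriorAlgebra K V)] M) (hf : ∀ j, ∀ x ∈ 𝒩 j, f x ∈ ℳ j) :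
    LinearMap.ker f ≤ Submodule.span (ExteriorAlgebra K V) {y | y ∈ LinearMap.ker f ∧ ∃ j, y ∈ 𝒩 j} := by
  intro x hx
  obtain ⟨s, y, hy, rfl⟩ := mem_span_hom hN x
  rw [LinearMap.mem_ker, map_sum] at hx
  refine Submodule.sum_mem _ fun j hj => Submodule.subset_span ⟨?_, j, hy j⟩
  exact (iSupIndep_iff_finsetSum_eq_zero_imp_eq_zero _).1 hM.internal.submodule_iSupIndep s
    (fun j => f (y j)) (fun j _ => hf j _ (hy j)) hx j hj

instance finite_ext [Module.Finite K V] : Module.Finite K (ExteriorAlgebra K V) :=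
  Module.Finite.of_basis (Module.finBasis K V).ExteriorAlgebra

lemma fg_of_finite [Module.Finite K V] {r : ℕ} (P : Submodule (ExteriorAlgebra K V) (Fin r → (ExteriorAlgebra K V))) : P.FG := by
  have : IsNoetherian (ExteriorAlgebra K V) (ExteriorAlgebra K V) := isNoetherian_of_tower K inferInstance
  exact IsNoetherian.noetherian P

theorem exists_resolution [Module.Finite K V] (hM : IsGraded V ℳ) (hfg : Module.Finite (ExteriorAlgebra K V) M) :
    Nonempty (GradedFreeResolution V ℳ) := by
  obtain ⟨r, δ, ε, hε, hεr⟩ := exists_cover hM ⊤ hfg.fg_top (by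
    rintro x -
    obtain ⟨s, y, hy, rfl⟩ := mem_span_hom hM x
    exact Submodule.sum_mem _ fun j _ => Submodule.subset_span ⟨trivial, j, hy j⟩)
  let St := {S : Σ r : ℕ, (Fin r → ℤ) × Submodule (ExteriorAlgebra K V)
    (Fin r → ExteriorAlgebra K V) // S.2.2 ≤ Submodule.span (ExteriorAlgebra K V)
      {y | y ∈ S.2.2 ∧ ∃ j, y ∈ freeDeg (K := K) S.2.1 j}}
  have cover : ∀ S : St, ∃ (r : ℕ) (deg : Fin r → ℤ)
      (f : (Fin r → ExteriorAlgebra K V) →ₗ[ExteriorAlgebra K V]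
        (Fin S.1.1 → ExteriorAlgebra K V)),
      (∀ j, ∀ x ∈ freeDeg (K := K) deg j, f x ∈ freeDeg (K := K) S.1.2.1 j) ∧
      LinearMap.range f = S.1.2.2 := fun S =>
    exists_cover (freeDeg_isGraded S.1.2.1) S.1.2.2 (fg_of_finite _) S.2
  choose nr nδ nf hnf hnr using cover
  let next : St → St := fun S => ⟨⟨nr S, nδ S, LinearMap.ker (nf S)⟩,
    ker_hom (freeDeg_isGraded _) (freeDeg_isGraded _) (nf S) (hnf S)⟩
  let seq : ℕ → St := fun i => Nat.rec
    ⟨⟨r, δ, LinearMap.ker ε⟩, ker_hom (freeDeg_isGraded _) hM ε hε⟩ (fun _ => next) i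
  exact ⟨{
    rank := fun i => (seq i).1.1
    deg := fun i => (seq i).1.2.1
    ε := ε
    d := fun i => nf (seq i)
    ε_mem := hε
    d_mem := fun i => hnf (seq i)
    range_ε := hεr
    range_d_zero := hnr (seq 0)
    range_d_succ := fun i => hnr (seq (i + 1)) }⟩

/-- `dim_K A / (A ∩ B)`, the dimension of the image of `A` in `N / B`. -/
noncomputable def dimMod {N : Type*} [AddCommGroup N] [Module K N] (A B : Submodule K N) : ℕ :=
  Module.finrank K (A ⧸ B.submoduleOf A)

/-- The `E`-submodule `E₊ N` of `N`, where `E₊` is the kernel of the augmentation `E → K`; thus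
`K ⊗_E N = N / E₊ N`. -/
def augSub (K : Type u) [Field K] (V : Type v) [AddCommGroup V] [Module K V]
    (N : Type*) [AddCommGroup N] [Module (ExteriorAlgebra K V) N] :
    Submodule (ExteriorAlgebra K V) N :=
  Submodule.span (ExteriorAlgebra K V)
    {y | ∃ a ∈ RingHom.ker (ExteriorAlgebra.algebraMapInv : ExteriorAlgebra K V →ₐ[K] K),
      ∃ x : N, y = a • x}

lemma augSub_le_comap {N N' : Type*} [AddCommGroup N] [Module (ExteriorAlgebra K V) N]
    [AddCommGroup N'] [Module (ExteriorAlgebra K V) N'] (f : N →ₗ[ExteriorAlgebra K V] N') :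
    augSub K V N ≤ (augSub K V N').comap f := by
  refine Submodule.span_le.2 ?_
  rintro _ ⟨a, ha, x, rfl⟩
  exact Submodule.subset_span ⟨a, ha, f x, by simp⟩

namespace GradedFreeResolution

variable (F : GradedFreeResolution V ℳ)

/-- `K ⊗_E F_i`, realised as `F_i / E₊ F_i`. -/
abbrev Tens (i : ℕ) : Type _ :=
  (Fin (F.rank i) → ExteriorAlgebra K V) ⧸ augSub K V (Fin (F.rank i) → ExteriorAlgebra K V)

/-- The induced differential `K ⊗_E F_{i+1} → K ⊗_E F_i`. -/
def tensD (i : ℕ) : F.Tens (i + 1) →ₗ[K] F.Tens i :=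
  (Submodule.mapQ _ _ (F.d i) (augSub_le_comap (F.d i))).restrictScalars K

/-- The degree `j` component of `K ⊗_E F_i`. -/
def tensDeg (i : ℕ) (j : ℤ) : Submodule K (F.Tens i) :=
  (freeDeg (K := K) (V := V) (F.deg i) j).map
    ((augSub K V (Fin (F.rank i) → ExteriorAlgebra K V)).mkQ.restrictScalars K)

/-- The cycles of the complex `K ⊗_E F` in homological degree `i`. -/
def cycles : ∀ i : ℕ, Submodule K (F.Tens i)
  | 0 => ⊤
  | i + 1 => LinearMap.ker (F.tensD i)

/-- `dim_K H_i(K ⊗_E F)_j`. -/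
noncomputable def betti (i : ℕ) (j : ℤ) : ℕ :=
  dimMod (F.cycles i ⊓ F.tensDeg i j) (LinearMap.range (F.tensD i))

end GradedFreeResolution

/-- The graded Betti number `β_{i,j}(M) = dim_K Tor_i^E(K, M)_j` of a finitely generated graded
`E`-module `M`: the dimension of `H_i(K ⊗_E F)_j` for a graded free resolution `F` of `M`. -/
noncomputable def gradedBetti [Module.Finite K V] (hM : IsGraded V ℳ)
    (hfg : Module.Finite (ExteriorAlgebra K V) M) (i : ℕ) (j : ℤ) : ℕ :=
  (Classical.choice (exists_resolution hM hfg)).betti i j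

/-- The submodule `(v₁, …, v_q) M`; the family `v` is indexed from `0`, so that `v_q` is the
entry of index `q - 1`. -/
def linMul (K : Type u) [Field K] {V : Type v} [AddCommGroup V] [Module K V]
    (M : Type w) [AddCommGroup M] [Module (ExteriorAlgebra K V) M]
    {n : ℕ} (v : Fin n → V) (q : ℕ) : Submodule (ExteriorAlgebra K V) M :=
  Submodule.span (ExteriorAlgebra K V)
    {y | ∃ a : Fin n, a.val < q ∧ ∃ x : M, y = ExteriorAlgebra.ι K (v a) • x}

variable [IsScalarTower K (ExteriorAlgebra K V) M]

/-- The colon submodule `(v₁, …, v_{p-1}) M :_M v_p`, where `v_p` is the entry of `v` of index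
`p - 1` (the Lean variable `p` is this index). -/
def colonLin (K : Type u) [Field K] {V : Type v} [AddCommGroup V] [Module K V]
    (M : Type w) [AddCommGroup M] [Module K M] [Module (ExteriorAlgebra K V) M]
    [IsScalarTower K (ExteriorAlgebra K V) M]
    {n : ℕ} (v : Fin n → V) (p : Fin n) : Submodule K M :=
  ((linMul K M v p.val).restrictScalars K).comap
    (Algebra.lsmul K K M (ExteriorAlgebra.ι K (v p)))

/-- `dim_K A_k` for `A = ((v₁, …, v_{p-1}) M :_M v_p) / (v₁, …, v_p) M` and the given linear
forms `v` (the Lean variable `p` is the index `p - 1`). -/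
noncomputable def annNumber (ℳ : ℤ → Submodule K M) {n : ℕ} (v : Fin n → V) (p : Fin n)
    (k : ℤ) : ℕ :=
  dimMod (colonLin K M v p ⊓ ℳ k) ((linMul K M v (p.val + 1)).restrictScalars K)

/-- `f v = c` for generic `v ∈ Vⁿ`: on a nonempty basic Zariski-open subset, the complement of the
zero set of a nonzero polynomial in the coordinates of the `v_a` (nonempty when `K` is infinite). -/
def IsGenericValue {n : ℕ} (e : Module.Basis (Fin n) K V) (f : (Fin n → V) → ℕ) (c : ℕ) : Prop :=
  ∃ P : MvPolynomial (Fin n × Fin n) K, P ≠ 0 ∧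
    ∀ v : Fin n → V, MvPolynomial.eval (fun s => e.repr (v s.1) s.2) P ≠ 0 → f v = c

lemma isGenericValue_unique [Infinite K] {n : ℕ} (e : Module.Basis (Fin n) K V)
    {f : (Fin n → V) → ℕ} {c c' : ℕ} (h : IsGenericValue e f c) (h' : IsGenericValue e f c') :
    c = c' := by
  obtain ⟨P, hP, h⟩ := h
  obtain ⟨P', hP', h'⟩ := h'
  by_contra hne
  refine mul_ne_zero hP hP' (MvPolynomial.funext fun x => ?_)
  by_contra hx
  rw [map_mul, map_zero] at hx
  have hv : (fun s : Fin n × Fin n => e.repr (∑ t, x (s.1, t) • e t) s.2) = x := by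
    funext s
    rw [e.repr_sum_self]
  have h1 := h (fun a => ∑ t, x (a, t) • e t) (by rw [hv]; exact left_ne_zero_of_mul hx)
  have h2 := h' (fun a => ∑ t, x (a, t) • e t) (by rw [hv]; exact right_ne_zero_of_mul hx)
  exact hne (h1.symm.trans h2)

lemma IsGenericValue.comp₂ {n : ℕ} {e : Module.Basis (Fin n) K V}
    {f g : (Fin n → V) → ℕ} {c c' : ℕ} (h : IsGenericValue e f c) (h' : IsGenericValue e g c')
    (op : ℕ → ℕ → ℕ) : IsGenericValue e (fun v => op (f v) (g v)) (op c c') := by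
  obtain ⟨P, hP, h⟩ := h
  obtain ⟨P', hP', h'⟩ := h'
  refine ⟨P * P', mul_ne_zero hP hP', fun v hv => ?_⟩
  rw [map_mul] at hv
  simp only [h v (left_ne_zero_of_mul hv), h' v (right_ne_zero_of_mul hv)]

lemma exists_generic_rank {n : ℕ} (e : Module.Basis (Fin n) K V)
    {X Y : Type*} [AddCommGroup X] [Module K X] [AddCommGroup Y] [Module K Y]
    [Module.Finite K X] [Module.Finite K Y] (T : (Fin n → V) → X →ₗ[K] Y)
    (hT : ∀ (x : X) (φ : Y →ₗ[K] K), ∃ P : MvPolynomial (Fin n × Fin n) K,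
      ∀ v, φ (T v x) = MvPolynomial.eval (fun s => e.repr (v s.1) s.2) P) :
    ∃ c, IsGenericValue e (fun v => Module.finrank K (LinearMap.range (T v))) c := by
  classical
  obtain ⟨v₀, hv₀⟩ : ∃ v₀, ∀ v, Module.finrank K (LinearMap.range (T v)) ≤
      Module.finrank K (LinearMap.range (T v₀)) := by
    have hb : BddAbove (Set.range fun v => Module.finrank K (LinearMap.range (T v))) :=
      ⟨Module.finrank K Y, by rintro _ ⟨v, rfl⟩; exact Submodule.finrank_le _⟩
    obtain ⟨v₀, h⟩ := Nat.sSup_mem (Set.range_nonempty _) hb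
    exact ⟨v₀, fun v => by
      have := le_csSup hb ⟨v, rfl⟩
      rwa [← h] at this⟩
  set r := Module.finrank K (LinearMap.range (T v₀)) with hr
  let B := Module.finBasis K (LinearMap.range (T v₀))
  obtain ⟨pr, hpr⟩ := (LinearMap.range (T v₀)).subtype.exists_leftInverse_of_injective
    (Submodule.ker_subtype _)
  have hx : ∀ j, ∃ x, T v₀ x = (B j : Y) := fun j => (B j).2
  choose x hx using hx
  let φ : Fin r → Y →ₗ[K] K := fun i => (B.coord i) ∘ₗ pr
  choose P hP using fun i j => hT (x j) (φ i)
  refine ⟨r, (Matrix.of P).det, ?_, fun v hv => ?_⟩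
  · intro h0
    have h1 := congrArg (MvPolynomial.eval (fun s => e.repr (v₀ s.1) s.2)) h0
    rw [RingHom.map_det, map_zero] at h1
    have : (MvPolynomial.eval (fun s => e.repr (v₀ s.1) s.2)).mapMatrix (Matrix.of P) = 1 := by
      ext i j
      have h2 : pr (B j : Y) = B j := LinearMap.congr_fun hpr (B j)
      simp [← hP, hx, φ, h2, Matrix.one_apply, Finsupp.single_apply, eq_comm]
    rw [this, Matrix.det_one] at h1
    exact one_ne_zero h1
  · refine le_antisymm (hv₀ v) ?_
    rw [RingHom.map_det] at hv
    have hli : LinearIndependent K (fun j => (⟨T v (x j), x j, rfl⟩ : LinearMap.range (T v))) := by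
      rw [Fintype.linearIndependent_iff]
      intro g hg
      have : ((MvPolynomial.eval (fun s => e.repr (v s.1) s.2)).mapMatrix
          (Matrix.of P)).mulVec g = 0 := by
        funext i
        have h3 := congrArg (fun y : LinearMap.range (T v) => φ i (y : Y)) hg
        simp only [AddSubmonoidClass.coe_finsetSum, map_sum, SetLike.val_smul, map_smul,
          ZeroMemClass.coe_zero, map_zero, smul_eq_mul] at h3
        simp only [Matrix.mulVec, dotProduct, RingHom.mapMatrix_apply, Matrix.map_apply,
          Matrix.of_apply, ← hP, Pi.zero_apply]
        rw [← h3]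
        exact Finset.sum_congr rfl fun j _ => mul_comm _ _
      exact congrFun (Matrix.eq_zero_of_mulVec_eq_zero hv this)
    simpa using hli.fintype_card_le_finrank


lemma mul_ι_eq (a : ExteriorAlgebra K V) (w : V) :
    ∃ a', a * ExteriorAlgebra.ι K w = ExteriorAlgebra.ι K w * a' := by
  induction a using ExteriorAlgebra.induction with
  | algebraMap c => exact ⟨_, Algebra.commutes c _⟩
  | ι x => exact ⟨-ExteriorAlgebra.ι K x, by
      rw [mul_neg, eq_neg_iff_add_eq_zero]; exact ExteriorAlgebra.ι_add_mul_swap x w⟩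
  | mul a b ha hb =>
    obtain ⟨a', ha⟩ := ha
    obtain ⟨b', hb⟩ := hb
    exact ⟨a' * b', by rw [mul_assoc, hb, ← mul_assoc, ha, mul_assoc]⟩
  | add a b ha hb =>
    obtain ⟨a', ha⟩ := ha
    obtain ⟨b', hb⟩ := hb
    exact ⟨a' + b', by rw [add_mul, ha, hb, mul_add]⟩

/-- The map `(x_a) ↦ ∑_{a < q} v_a x_a`. -/
noncomputable def linMap (K : Type u) [Field K] {V : Type v} [AddCommGroup V] [Module K V]
    (M : Type w) [AddCommGroup M] [Module K M] [Module (ExteriorAlgebra K V) M]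
    [IsScalarTower K (ExteriorAlgebra K V) M] {n : ℕ} (q : ℕ) (v : Fin n → V) :
    (Fin n → M) →ₗ[K] M :=
  ∑ a : Fin n, if a.val < q then
    Algebra.lsmul K K M (ExteriorAlgebra.ι K (v a)) ∘ₗ LinearMap.proj a else 0

lemma range_linMap {n : ℕ} (q : ℕ) (v : Fin n → V) :
    LinearMap.range (linMap K M q v) = (linMul K M v q).restrictScalars K := by
  apply le_antisymm
  · rintro _ ⟨x, rfl⟩
    rw [linMap, LinearMap.sum_apply]
    refine Submodule.sum_mem _ fun a _ => ?_
    split_ifs with h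
    · exact Submodule.subset_span ⟨a, h, x a, rfl⟩
    · simp
  · intro y hy
    have hy : y ∈ linMul K M v q := hy
    refine Submodule.span_induction (p := fun y _ => y ∈ LinearMap.range (linMap K M q v))
      ?_ (zero_mem _) (fun _ _ _ _ => add_mem) ?_ hy
    · rintro _ ⟨a, ha, x, rfl⟩
      refine ⟨Pi.single a x, ?_⟩
      rw [linMap, LinearMap.sum_apply, Finset.sum_eq_single a]
      · simp [ha]
      · intro b _ hb
        split_ifs <;> simp [Pi.single_eq_of_ne hb]
      · simp
    · rintro b _ - ⟨x, rfl⟩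
      choose b' hb' using fun a => mul_ι_eq b (v a)
      refine ⟨fun a => b' a • x a, ?_⟩
      rw [linMap, LinearMap.sum_apply, LinearMap.sum_apply, Finset.smul_sum]
      refine Finset.sum_congr rfl fun a _ => ?_
      split_ifs
      · simp [smul_smul, hb']
      · simp

lemma finrank_comap_range {X Y Z : Type*} [AddCommGroup X] [Module K X] [AddCommGroup Y]
    [Module K Y] [AddCommGroup Z] [Module K Z] [Module.Finite K X] [Module.Finite K Y]
    (L : X →ₗ[K] Y) (S : Z →ₗ[K] Y) :
    Module.finrank K ((LinearMap.range S).comap L) =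
      Module.finrank K X + Module.finrank K (LinearMap.range S) -
        Module.finrank K (LinearMap.range (L.coprod S)) := by
  set W := LinearMap.range S
  have h1 := LinearMap.finrank_range_add_finrank_ker (W.mkQ ∘ₗ L)
  have h2 := LinearMap.finrank_range_add_finrank_ker (W.mkQ.domRestrict (LinearMap.range L ⊔ W))
  rw [LinearMap.ker_comp, Submodule.ker_mkQ, LinearMap.range_comp] at h1
  rw [LinearMap.range_domRestrict, Submodule.map_sup, Submodule.mkQ_map_self, sup_bot_eq,
    LinearMap.ker_domRestrict, Submodule.ker_mkQ] at h2
  have h3 := (Submodule.submoduleOfEquivOfLe (le_sup_right : W ≤ LinearMap.range L ⊔ W)).finrank_eq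
  rw [Submodule.submoduleOf] at h3
  rw [LinearMap.range_coprod]
  change _ = _ + Module.finrank K W - Module.finrank K ↥(LinearMap.range L ⊔ W)
  omega

lemma poly_smul {n : ℕ} (e : Module.Basis (Fin n) K V) (a : Fin n) (x : M) (φ : M →ₗ[K] K) :
    ∃ P : MvPolynomial (Fin n × Fin n) K, ∀ v : Fin n → V,
      φ (ExteriorAlgebra.ι K (v a) • x) = MvPolynomial.eval (fun s => e.repr (v s.1) s.2) P := by
  refine ⟨∑ t, MvPolynomial.X (a, t) * MvPolynomial.C (φ (ExteriorAlgebra.ι K (e t) • x)),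
    fun v => ?_⟩
  have h : ExteriorAlgebra.ι K (v a) • x =
      ∑ t, e.repr (v a) t • (ExteriorAlgebra.ι K (e t) • x) := by
    conv_lhs => rw [← e.sum_repr (v a)]
    simp only [map_sum, map_smul, Finset.sum_smul, smul_assoc]
  simp [h]

lemma poly_linMap {n : ℕ} (e : Module.Basis (Fin n) K V) (q : ℕ) (x : Fin n → M)
    (φ : M →ₗ[K] K) :
    ∃ P : MvPolynomial (Fin n × Fin n) K, ∀ v : Fin n → V,
      φ (linMap K M q v x) = MvPolynomial.eval (fun s => e.repr (v s.1) s.2) P := by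
  choose P hP using fun a => poly_smul (K := K) e a (x a) φ
  refine ⟨∑ a, if a.val < q then P a else 0, fun v => ?_⟩
  rw [linMap, LinearMap.sum_apply, map_sum, map_sum]
  refine Finset.sum_congr rfl fun a _ => ?_
  split_ifs
  · simpa using hP a v
  · simp

lemma linMul_le_colonLin {n : ℕ} (v : Fin n → V) (p : Fin n) :
    (linMul K M v (p.val + 1)).restrictScalars K ≤ colonLin K M v p := by
  rw [← range_linMap]
  rintro _ ⟨x, rfl⟩
  rw [linMap, LinearMap.sum_apply]
  refine Submodule.sum_mem _ fun a _ => ?_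
  split_ifs with h
  · change ExteriorAlgebra.ι K (v p) • ExteriorAlgebra.ι K (v a) • x a ∈ linMul K M v p.val
    rcases Nat.lt_succ_iff_lt_or_eq.1 h with h | h
    · exact Submodule.smul_mem _ _ (Submodule.subset_span ⟨a, h, x a, rfl⟩)
    · rw [Fin.ext h, smul_smul, ExteriorAlgebra.ι_sq_zero, zero_smul]
      exact zero_mem _
  · simp

theorem exists_annNumber [Module.Finite K V] (hfg : Module.Finite (ExteriorAlgebra K V) M)
    (ℳ : ℤ → Submodule K M) {n : ℕ} (e : Module.Basis (Fin n) K V) (p : Fin n) (k : ℤ) :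
    ∃ c, IsGenericValue e (fun v => annNumber ℳ v p k) c := by
  have : Module.Finite K M := Module.Finite.trans (ExteriorAlgebra K V) M
  obtain ⟨c₁, h₁⟩ := exists_generic_rank e (fun v => linMap K M p.val v) (poly_linMap e _)
  obtain ⟨c₂, h₂⟩ := exists_generic_rank e (fun v => linMap K M (p.val + 1) v) (poly_linMap e _)
  obtain ⟨c₃, h₃⟩ := exists_generic_rank e (fun v =>
      (Algebra.lsmul K K M (ExteriorAlgebra.ι K (v p)) ∘ₗ (ℳ k).subtype).coprod
        (linMap K M p.val v)) (by
    rintro ⟨x, y⟩ φ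
    obtain ⟨P, hP⟩ := poly_smul (K := K) e p (x : M) φ
    obtain ⟨Q, hQ⟩ := poly_linMap e p.val y φ
    exact ⟨P + Q, fun v => by simp [← hP, ← hQ]⟩)
  obtain ⟨c₄, h₄⟩ := exists_generic_rank e (fun v =>
      (ℳ k).subtype.coprod (linMap K M (p.val + 1) v)) (by
    rintro ⟨x, y⟩ φ
    obtain ⟨Q, hQ⟩ := poly_linMap e (p.val + 1) y φ
    exact ⟨MvPolynomial.C (φ x) + Q, fun v => by simp [← hQ]⟩)
  have h := (h₁.comp₂ h₃ fun r s => Module.finrank K (ℳ k) + r - s).comp₂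
    (h₂.comp₂ h₄ fun r s => Module.finrank K (ℳ k) + r - s) fun r s => r - s
  refine ⟨_, (congrArg (fun f => IsGenericValue e f _) (funext fun v => ?_)).mpr h⟩
  rw [← finrank_comap_range, ← finrank_comap_range, range_linMap, range_linMap]
  have hq := Submodule.finrank_quotient_add_finrank
    (((linMul K M v (p.val + 1)).restrictScalars K).submoduleOf (colonLin K M v p ⊓ ℳ k))
  have e1 : Module.finrank K (((linMul K M v p.val).restrictScalars K).comap
      (Algebra.lsmul K K M (ExteriorAlgebra.ι K (v p)) ∘ₗ (ℳ k).subtype)) =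
      Module.finrank K ↥(colonLin K M v p ⊓ ℳ k) := by
    rw [Submodule.comap_comp, ← Submodule.finrank_map_subtype_eq, Submodule.map_comap_subtype,
      inf_comm]
    rfl
  have e2 : Module.finrank K (((linMul K M v (p.val + 1)).restrictScalars K).comap
      (ℳ k).subtype) = Module.finrank K
        (((linMul K M v (p.val + 1)).restrictScalars K).submoduleOf (colonLin K M v p ⊓ ℳ k)) := by
    rw [← Submodule.finrank_map_subtype_eq, Submodule.map_comap_subtype, Submodule.submoduleOf,
      ← Submodule.finrank_map_subtype_eq (colonLin K M v p ⊓ ℳ k), Submodule.map_comap_subtype,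
      inf_right_comm, inf_eq_right.2 (linMul_le_colonLin v p), inf_comm]
  rw [e1, e2, ← hq, Nat.add_sub_cancel]
  rfl

/-- The exterior generic annihilator number `α_{p+1,k}(M)`: the value of `annNumber ℳ v p k` for
generic linear forms `v` (unique over an infinite field by `isGenericValue_unique`). -/
noncomputable def genericAnnNumber [Module.Finite K V]
    (hfg : Module.Finite (ExteriorAlgebra K V) M)
    (ℳ : ℤ → Submodule K M) {n : ℕ} (e : Module.Basis (Fin n) K V) (p : Fin n) (k : ℤ) : ℕ :=
  Classical.choose (exists_annNumber hfg ℳ e p k)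

end
end ExteriorGraded

/-!
Let `b` be a basis of `V` which is generic in the sense that its annihilator numbers are the generic
ones (`exists_basis_of_isGenericValue`), and let `F` be a graded free resolution of `M`. Write
`I_m = (b_0, …, b_{m-1})` and `H_q(m) = H_q(F / I_m F)`. Then `H_q(0) = 0` for `q ≥ 1`,
`H_q(n) = Tor_q(K, M)`, and `H_0(m) = M / I_m M`. A linear form `b_m` is regular on `F / I_m F` in the
exterior sense: its annihilator is `b_m F`. This is seen by contracting with the dual functional. Hence
there are exact sequences `0 → F / I_{m+1} F → F / I_m F → F / I_{m+1} F → 0`, the first map being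
multiplication by `b_m`, and long exact sequences
`H_q(m+1)_{j-1} → H_q(m)_j → H_q(m+1)_j → H_{q-1}(m+1)_{j-1} → H_{q-1}(m)_j`. The kernel of the
last map for `q = 1` has dimension the annihilator number of `b_m` in degree `j - 1`.

Counting dimensions along the strand `j = q + k` gives a Pascal recursion, so that `dim H_q(m)` is
bounded by the binomial sum, with equality exactly when the multiplications by `b_m` occurring in the
sequences vanish. Equality at one `q ≥ 2` and `m = n` descends through the recursion and gives the
vanishing of these multiplications on `H_1(m+1)` in degrees `k` and `k + 1`, for all `m < n`
(`errors_eq_zero_of_eq_binomSum`).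

The decisive point (`IsRegularComplex.cyc_le_colon_succ`) is that vanishing on `H_q(m+1)` in degree `j`
for all `m < n` implies vanishing on `H_{q+1}(m+1)` in degree `j + 1` for all `m < n`. If `z` is a cycle
modulo `I_{m+1}` then `d z = ∑ b_a w_a`, and the `w_a` represent classes of `H_q(m+1)`, so the
`b_m w_a` are boundaries modulo `I_m`. Subtracting these boundaries changes `b_m z` into an element
whose differential lies in `I_m² F`, and `IsRegularComplex.mem_bdry_of_d_eq_sum` shows by induction on
`m` that such an element is a boundary modulo `I_m`.

Homology is not formed as a quotient: `cyc` and `bdry` are the homogeneous parts of the preimages in `F`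
of the cycles and the boundaries of `F / I_m F`, and `colon` is the preimage of the kernel of
multiplication by `b_m`.
-/

universe u v w

namespace ExteriorGraded

/-! ### Complexes with anticommuting regular operators -/

section
variable {K : Type*} [Field K] {X : ℕ → Type*} [∀ q, AddCommGroup (X q)] [∀ q, Module K (X q)]

/-- The degree `j` part of `(v 0, …, v (m - 1)) X_q`. -/
def linPart (deg : ∀ q, ℤ → Submodule K (X q)) (v : ℕ → ∀ q, X q →ₗ[K] X q) :
    ℕ → ∀ q, ℤ → Submodule K (X q)
  | 0, _, _ => ⊥
  | m + 1, q, j => linPart deg v m q j ⊔ (deg q (j - 1)).map (v m q)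

/-- `X` is an acyclic complex `⋯ → X₁ → X₀` of `K`-vector spaces, each with a family of subspaces
`deg q j` (its degree `j` part), and `v 0, v 1, …` are anticommuting square-zero operators of degree
one on it which commute with the differential. The sequence `v 0, …, v (n - 1)` is regular in the
sense appropriate to exterior algebras: `v m x ∈ (v 0, …, v (m - 1)) X` only if
`x ∈ (v 0, …, v m) X`. No condition is put on the homology at `X₀`. -/
structure IsRegularComplex (n : ℕ) (deg : ∀ q, ℤ → Submodule K (X q))
    (d : ∀ q, X (q + 1) →ₗ[K] X q) (v : ℕ → ∀ q, X q →ₗ[K] X q) : Prop where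
  d_mem : ∀ {q j x}, x ∈ deg (q + 1) j → d q x ∈ deg q j
  v_mem : ∀ {a q j x}, x ∈ deg q (j - 1) → v a q x ∈ deg q j
  d_v : ∀ a q x, d q (v a (q + 1) x) = v a q (d q x)
  v_v : ∀ a b q x, v a q (v b q x) = - v b q (v a q x)
  v_sq : ∀ a q x, v a q (v a q x) = 0
  d_d : ∀ q x, d q (d (q + 1) x) = 0
  exact : ∀ {q j x}, x ∈ deg (q + 1) j → d q x = 0 → ∃ y ∈ deg (q + 2) j, d (q + 1) y = x
  regular : ∀ {m q j x}, m < n → x ∈ deg q (j - 1) → v m q x ∈ linPart deg v m q j →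
    x ∈ linPart deg v (m + 1) q (j - 1)

/-- The degree `j` part of `d X_{q+1} + (v 0, …, v (m - 1)) X_q`, the preimage in `X_q` of the
boundaries of `X / (v 0, …, v (m - 1)) X`. -/
def bdry (deg : ∀ q, ℤ → Submodule K (X q)) (d : ∀ q, X (q + 1) →ₗ[K] X q)
    (v : ℕ → ∀ q, X q →ₗ[K] X q) (m q : ℕ) (j : ℤ) : Submodule K (X q) :=
  (deg (q + 1) j).map (d q) ⊔ linPart deg v m q j

/-- The degree `j` part of the preimage in `X_{q+1}` of the cycles of
`X / (v 0, …, v (m - 1)) X`. -/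
def cyc (deg : ∀ q, ℤ → Submodule K (X q)) (d : ∀ q, X (q + 1) →ₗ[K] X q)
    (v : ℕ → ∀ q, X q →ₗ[K] X q) (m q : ℕ) (j : ℤ) : Submodule K (X (q + 1)) :=
  deg (q + 1) j ⊓ (linPart deg v m q j).comap (d q)

/-- The elements of `X_q` of degree `j - 1` which `v m` multiplies into the preimage of the
boundaries of `X / (v 0, …, v (m - 1)) X`. -/
def colon (deg : ∀ q, ℤ → Submodule K (X q)) (d : ∀ q, X (q + 1) →ₗ[K] X q)
    (v : ℕ → ∀ q, X q →ₗ[K] X q) (m q : ℕ) (j : ℤ) : Submodule K (X q) :=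
  deg q (j - 1) ⊓ (bdry deg d v m q j).comap (v m q)

variable {n : ℕ} {deg : ∀ q, ℤ → Submodule K (X q)} {d : ∀ q, X (q + 1) →ₗ[K] X q}
  {v : ℕ → ∀ q, X q →ₗ[K] X q}

lemma mem_linPart_iff {m q : ℕ} {j : ℤ} {x : X q} : x ∈ linPart deg v m q j ↔
    ∃ w : ℕ → X q, (∀ a, w a ∈ deg q (j - 1)) ∧ x = ∑ a ∈ Finset.range m, v a q (w a) := by
  induction m generalizing x with
  | zero =>
    simp only [linPart, Submodule.mem_bot, Finset.range_zero, Finset.sum_empty]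
    exact ⟨fun h => ⟨0, fun _ => zero_mem _, h⟩, fun ⟨_, _, h⟩ => h⟩
  | succ m ih =>
    rw [linPart, Submodule.mem_sup]
    constructor
    · rintro ⟨y, hy, _, ⟨u, hu, rfl⟩, rfl⟩
      obtain ⟨w, hw, rfl⟩ := ih.1 hy
      refine ⟨Function.update w m u, fun a => ?_, ?_⟩
      · by_cases h : a = m
        · subst h; simpa using hu
        · simpa [h] using hw a
      · rw [Finset.sum_range_succ, Function.update_self]
        congr 1
        refine Finset.sum_congr rfl fun a ha => ?_
        rw [Function.update_of_ne (Finset.mem_range.1 ha).ne]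
    · rintro ⟨w, hw, rfl⟩
      exact ⟨_, ih.2 ⟨w, hw, rfl⟩, _, ⟨w m, hw m, rfl⟩, (Finset.sum_range_succ _ _).symm⟩

lemma linPart_mono {m m' : ℕ} (h : m ≤ m') (q : ℕ) (j : ℤ) :
    linPart deg v m q j ≤ linPart deg v m' q j :=
  monotone_nat_of_le_succ (f := fun m => linPart deg v m q j) (fun _ => le_sup_left) h

lemma bdry_mono {m m' : ℕ} (h : m ≤ m') (q : ℕ) (j : ℤ) :
    bdry deg d v m q j ≤ bdry deg d v m' q j :=
  sup_le_sup_left (linPart_mono h q j) _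

lemma cyc_mono {m m' : ℕ} (h : m ≤ m') (q : ℕ) (j : ℤ) :
    cyc deg d v m q j ≤ cyc deg d v m' q j :=
  inf_le_inf_left _ (Submodule.comap_mono (linPart_mono h q j))

lemma v_mem_linPart {a m q : ℕ} {j : ℤ} {x : X q} (ha : a < m) (hx : x ∈ deg q (j - 1)) :
    v a q x ∈ linPart deg v m q j :=
  linPart_mono (Nat.succ_le_of_lt ha) q j
    (Submodule.mem_sup_right (Submodule.mem_map_of_mem hx))

namespace IsRegularComplex

variable (h : IsRegularComplex n deg d v)
include h

lemma linPart_le (m q : ℕ) (j : ℤ) : linPart deg v m q j ≤ deg q j := by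
  intro x hx
  obtain ⟨w, hw, rfl⟩ := mem_linPart_iff.1 hx
  exact Submodule.sum_mem _ fun a _ => h.v_mem (hw a)

lemma d_mem_linPart {m q : ℕ} {j : ℤ} {x : X (q + 1)} (hx : x ∈ linPart deg v m (q + 1) j) :
    d q x ∈ linPart deg v m q j := by
  obtain ⟨w, hw, rfl⟩ := mem_linPart_iff.1 hx
  refine mem_linPart_iff.2 ⟨fun a => d q (w a), fun a => h.d_mem (hw a), ?_⟩
  simp [h.d_v]

lemma v_mem_linPart_of_mem {m q : ℕ} {j : ℤ} {x : X q} (b : ℕ)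
    (hx : x ∈ linPart deg v m q (j - 1)) : v b q x ∈ linPart deg v m q j := by
  obtain ⟨w, hw, rfl⟩ := mem_linPart_iff.1 hx
  refine mem_linPart_iff.2 ⟨fun a => - v b q (w a), fun a => neg_mem (h.v_mem (hw a)), ?_⟩
  rw [map_sum]
  exact Finset.sum_congr rfl fun a _ => by rw [h.v_v, map_neg]

lemma bdry_le (m q : ℕ) (j : ℤ) : bdry deg d v m q j ≤ deg q j := by
  refine sup_le ?_ (h.linPart_le m q j)
  rintro _ ⟨x, hx, rfl⟩
  exact h.d_mem hx

lemma bdry_le_cyc (m q : ℕ) (j : ℤ) : bdry deg d v m (q + 1) j ≤ cyc deg d v m q j := by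
  refine le_inf (h.bdry_le m _ j) (sup_le ?_ fun x hx => h.d_mem_linPart hx)
  rintro _ ⟨x, hx, rfl⟩
  simp [h.d_d]

/-- The coefficients of a relation `∑ v_a w_a = 0` lie in the submodule generated by the `v_a`. -/
lemma coeff_mem_linPart {m q : ℕ} {j : ℤ} (hm : m ≤ n) (w : ℕ → X q)
    (hw : ∀ a, w a ∈ deg q (j - 1)) (h0 : ∑ a ∈ Finset.range m, v a q (w a) = 0) :
    ∀ a < m, w a ∈ linPart deg v m q (j - 1) := by
  induction m generalizing w with
  | zero => exact fun a ha => absurd ha (by omega)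
  | succ m ih =>
    rw [Finset.sum_range_succ] at h0
    have hwm : w m ∈ linPart deg v (m + 1) q (j - 1) := by
      refine h.regular hm (hw m) ?_
      rw [← neg_eq_of_add_eq_zero_right h0]
      exact neg_mem (mem_linPart_iff.2 ⟨w, hw, rfl⟩)
    obtain ⟨u, hu, hu'⟩ := mem_linPart_iff.1 hwm
    have hz : ∀ a, v m q (u a) ∈ deg q (j - 1) := fun a => h.v_mem (hu a)
    have key := ih (by omega) (fun a => w a - v m q (u a)) (fun a => sub_mem (hw a) (hz a)) (by
      rw [← h0, hu', map_sum, Finset.sum_range_succ, h.v_sq, add_zero, ← Finset.sum_add_distrib]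
      refine Finset.sum_congr rfl fun a _ => ?_
      rw [map_sub, h.v_v m a, sub_eq_add_neg])
    intro a ha
    rcases Nat.lt_succ_iff_lt_or_eq.1 ha with ha | rfl
    · rw [← sub_add_cancel (w a) (v m q (u a))]
      exact add_mem (linPart_mono (Nat.le_succ m) q _ (key a ha))
        (v_mem_linPart (Nat.lt_succ_self m) (hu a))
    · exact hwm

lemma colon_le_cyc {m : ℕ} (hm : m < n) (q : ℕ) (j : ℤ) :
    colon deg d v m (q + 1) j ≤ cyc deg d v (m + 1) q (j - 1) := by
  rintro x ⟨hx, hx'⟩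
  obtain ⟨_, ⟨y, hy, rfl⟩, l, hl, hyl⟩ := Submodule.mem_sup.1 hx'
  refine ⟨hx, h.regular hm (h.d_mem hx) ?_⟩
  rw [← h.d_v, ← hyl, map_add, h.d_d, zero_add]
  exact h.d_mem_linPart hl

lemma bdry_le_colon (m q : ℕ) (j : ℤ) :
    bdry deg d v (m + 1) q (j - 1) ≤ colon deg d v m q j := by
  refine le_inf (h.bdry_le _ _ _) (sup_le ?_ (sup_le ?_ ?_))
  · rintro _ ⟨x, hx, rfl⟩
    rw [Submodule.mem_comap, ← h.d_v]
    exact Submodule.mem_sup_left (Submodule.mem_map_of_mem (h.v_mem hx))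
  · intro x hx
    exact Submodule.mem_sup_right (h.v_mem_linPart_of_mem m hx)
  · rintro _ ⟨x, hx, rfl⟩
    simp [h.v_sq]

/-- The map `H_{q+1}(X / (v 0, …, v (m-1))) → H_{q+1}(X / (v 0, …, v m))` is injective in degree
`j` if and only if the map preceding it in the long exact sequence, multiplication by `v m`,
vanishes. -/
lemma cyc_inf_bdry_le_iff {m : ℕ} (hm : m < n) (q : ℕ) (j : ℤ) :
    cyc deg d v m q j ⊓ bdry deg d v (m + 1) (q + 1) j ≤ bdry deg d v m (q + 1) j ↔
      cyc deg d v (m + 1) q (j - 1) ≤ colon deg d v m (q + 1) j := by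
  constructor
  · rintro H z ⟨hz, hz'⟩
    refine ⟨hz, H ⟨⟨h.v_mem hz, ?_⟩, Submodule.mem_sup_right
      (v_mem_linPart (Nat.lt_succ_self m) hz)⟩⟩
    obtain ⟨l, hl, _, ⟨u, hu, rfl⟩, hz'⟩ := Submodule.mem_sup.1 hz'
    rw [SetLike.mem_coe, Submodule.mem_comap, h.d_v, ← hz', map_add, h.v_sq, add_zero]
    exact h.v_mem_linPart_of_mem m hl
  · rintro H x ⟨⟨hx, hx'⟩, hb⟩
    obtain ⟨_, ⟨y, hy, rfl⟩, _, hl', rfl⟩ := Submodule.mem_sup.1 hb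
    obtain ⟨l, hl, _, ⟨u, hu, rfl⟩, rfl⟩ := Submodule.mem_sup.1 hl'
    rw [SetLike.mem_coe, Submodule.mem_comap, map_add, h.d_d, zero_add, map_add, h.d_v,
      Submodule.add_mem_iff_right _ (h.d_mem_linPart hl)] at hx'
    have := (H ⟨hu, h.regular hm (h.d_mem hu) hx'⟩).2
    rw [← add_assoc]
    exact add_mem (Submodule.add_mem_sup (Submodule.mem_map_of_mem hy) hl) this

/-- If multiplication by each `v m` vanishes from the homology of `X / (v 0, …, v m)` in
homological degree `q + 1` and internal degree `j - 1`, then an element `y` of `X_{q+2}` with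
`d y ∈ (v 0, …, v (m-1))² X` represents zero in the homology of `X / (v 0, …, v (m-1))`. -/
lemma mem_bdry_of_d_eq_sum {q : ℕ} {j : ℤ}
    (H : ∀ m < n, cyc deg d v (m + 1) q (j - 1 - 1) ≤ colon deg d v m (q + 1) (j - 1))
    {m : ℕ} (hm : m ≤ n) {y : X (q + 2)} (hy : y ∈ deg (q + 2) j) (w : ℕ → X (q + 1))
    (hw : ∀ a < m, w a ∈ linPart deg v m (q + 1) (j - 1))
    (hd : d (q + 1) y = ∑ a ∈ Finset.range m, v a (q + 1) (w a)) :
    y ∈ bdry deg d v m (q + 2) j := by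
  induction m generalizing y w with
  | zero =>
    obtain ⟨z, hz, rfl⟩ := h.exact hy (by simpa using hd)
    exact Submodule.mem_sup_left (Submodule.mem_map_of_mem hz)
  | succ m ih =>
    -- The products with `v m` are moved into the coefficients of the other `v a`.
    obtain ⟨u, hu, hwm⟩ := mem_linPart_iff.1 (hw m (Nat.lt_succ_self m))
    set w' : ℕ → X (q + 1) := fun a => if a < m then w a - v m (q + 1) (u a) else 0 with hw'_def
    have hw' : ∀ a, w' a ∈ linPart deg v (m + 1) (q + 1) (j - 1) := by
      intro a
      simp only [hw'_def]
      split_ifs with ha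
      · exact sub_mem (hw a (by omega)) (v_mem_linPart (Nat.lt_succ_self m) (hu a))
      · exact zero_mem _
    have hw'd : ∀ a, w' a ∈ deg (q + 1) (j - 1) := fun a => h.linPart_le _ _ _ (hw' a)
    have hd' : d (q + 1) y = ∑ a ∈ Finset.range m, v a (q + 1) (w' a) := by
      rw [hd, Finset.sum_range_succ, hwm, map_sum, Finset.sum_range_succ, h.v_sq, add_zero,
        ← Finset.sum_add_distrib]
      refine Finset.sum_congr rfl fun a ha => ?_
      rw [hw'_def]
      simp only [Finset.mem_range.1 ha, if_true]
      rw [map_sub, h.v_v m a, sub_eq_add_neg]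
    have hcyc : ∀ a < m, w' a ∈ bdry deg d v m (q + 1) (j - 1) := by
      have hrel := h.coeff_mem_linPart (j := j) (Nat.le_of_succ_le hm) (fun a => d q (w' a))
        (fun a => h.d_mem (hw'd a)) (by
          have := congrArg (d q) hd'
          rw [h.d_d, map_sum] at this
          rw [this]
          exact Finset.sum_congr rfl fun a _ => (h.d_v a q _).symm)
      intro a ha
      exact (h.cyc_inf_bdry_le_iff hm q (j - 1)).2 (H m hm)
        ⟨⟨hw'd a, hrel a ha⟩, Submodule.mem_sup_right (hw' a)⟩
    have hex : ∀ a, ∃ f ∈ deg (q + 2) (j - 1), ∃ l ∈ linPart deg v m (q + 1) (j - 1),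
        w' a = d (q + 1) f + l := by
      intro a
      by_cases ha : a < m
      · obtain ⟨_, ⟨f, hf, rfl⟩, l, hl, e⟩ := Submodule.mem_sup.1 (hcyc a ha)
        exact ⟨f, hf, l, hl, e.symm⟩
      · exact ⟨0, zero_mem _, 0, zero_mem _, by simp [hw'_def, ha]⟩
    choose f hf l hl e using hex
    have hs : ∑ a ∈ Finset.range m, v a (q + 2) (f a) ∈ linPart deg v m (q + 2) j :=
      mem_linPart_iff.2 ⟨f, hf, rfl⟩
    have := ih (Nat.le_of_succ_le hm) (sub_mem hy (h.linPart_le _ _ _ hs)) l (fun a _ => hl a) (by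
      rw [map_sub, hd', map_sum, ← Finset.sum_sub_distrib]
      refine Finset.sum_congr rfl fun a _ => ?_
      rw [e, map_add, h.d_v, add_sub_cancel_left])
    rw [← sub_add_cancel y (∑ a ∈ Finset.range m, v a (q + 2) (f a))]
    exact bdry_mono (Nat.le_succ m) _ _ (add_mem this (Submodule.mem_sup_right hs))

/-- If multiplication by every `v m` vanishes on homology in homological degree `q + 1` and
internal degree `j - 1`, then the same holds in degrees `q + 2` and `j`. -/
lemma cyc_le_colon_succ {q : ℕ} {j : ℤ}
    (H : ∀ m < n, cyc deg d v (m + 1) q (j - 1) ≤ colon deg d v m (q + 1) j) :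
    ∀ m < n, cyc deg d v (m + 1) (q + 1) j ≤ colon deg d v m (q + 2) (j + 1) := by
  obtain ⟨j, rfl⟩ : ∃ j', j = j' - 1 := ⟨j + 1, by ring⟩
  rw [sub_add_cancel]
  rintro m hm z ⟨hz, hz'⟩
  refine ⟨hz, ?_⟩
  rw [SetLike.mem_coe, Submodule.mem_comap] at hz'
  obtain ⟨w, hw, hdz⟩ := mem_linPart_iff.1 hz'
  have hdw : ∀ a < m + 1, w a ∈ cyc deg d v (m + 1) q (j - 1 - 1) := by
    intro a ha
    refine ⟨hw a, h.coeff_mem_linPart (j := j - 1) hm (fun a => d q (w a))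
      (fun a => h.d_mem (hw a)) ?_ a ha⟩
    have := congrArg (d q) hdz
    rw [h.d_d, map_sum] at this
    rw [this]
    exact Finset.sum_congr rfl fun a _ => (h.d_v a q _).symm
  have hex : ∀ a, ∃ f ∈ deg (q + 2) (j - 1), ∃ l ∈ linPart deg v m (q + 1) (j - 1),
      a < m → v m (q + 1) (w a) = d (q + 1) f + l := by
    intro a
    by_cases ha : a < m
    · obtain ⟨_, ⟨f, hf, rfl⟩, l, hl, e⟩ := Submodule.mem_sup.1 (H m hm (hdw a (by omega))).2
      exact ⟨f, hf, l, hl, fun _ => e.symm⟩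
    · exact ⟨0, zero_mem _, 0, zero_mem _, fun h => absurd h ha⟩
  choose f hf l hl e using hex
  have hs : ∑ a ∈ Finset.range m, v a (q + 2) (f a) ∈ linPart deg v m (q + 2) j :=
    mem_linPart_iff.2 ⟨f, hf, rfl⟩
  have := h.mem_bdry_of_d_eq_sum H hm.le
    (add_mem (h.v_mem hz) (h.linPart_le _ _ _ hs)) (fun a => - l a)
    (fun a _ => neg_mem (hl a)) (by
      rw [map_add, h.d_v, hdz, map_sum, map_sum, Finset.sum_range_succ, h.v_sq, add_zero,
        ← Finset.sum_add_distrib]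
      refine Finset.sum_congr rfl fun a ha => ?_
      rw [h.d_v, h.v_v m a, e a (Finset.mem_range.1 ha), map_add, map_neg]
      abel)
  rw [SetLike.mem_coe, Submodule.mem_comap, ← add_sub_cancel_right (v m (q + 2) z)
    (∑ a ∈ Finset.range m, v a (q + 2) (f a))]
  exact sub_mem this (Submodule.mem_sup_right hs)

end IsRegularComplex
end

/-! ### Counting dimensions -/

section
variable {K : Type*} [Field K]

lemma finrank_add_finrank_map_of_inf_ker_le {Y Z : Type*} [AddCommGroup Y] [Module K Y]
    [AddCommGroup Z] [Module K Z] [Module.Finite K Y] (f : Y →ₗ[K] Z) {A' A : Submodule K Y}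
    (hle : A' ≤ A) (hker : A ⊓ LinearMap.ker f ≤ A') :
    Module.finrank K A + Module.finrank K (A'.map f) =
      Module.finrank K A' + Module.finrank K (A.map f) := by
  have key : ∀ B : Submodule K Y, Module.finrank K (B.map f) +
      Module.finrank K ↥(B ⊓ LinearMap.ker f) = Module.finrank K B := by
    intro B
    have := LinearMap.finrank_range_add_finrank_ker (f.domRestrict B)
    rw [LinearMap.range_domRestrict, LinearMap.ker_domRestrict,
      ← Submodule.finrank_map_subtype_eq, Submodule.map_comap_subtype] at this
    exact this
  have h1 := key A
  have h2 := key A'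
  have h3 : A ⊓ LinearMap.ker f = A' ⊓ LinearMap.ker f :=
    le_antisymm (le_inf hker inf_le_right) (inf_le_inf_right _ hle)
  rw [h3] at h1
  omega

variable {X : ℕ → Type*} [∀ q, AddCommGroup (X q)] [∀ q, Module K (X q)]
  [∀ q, Module.Finite K (X q)]
variable {n : ℕ} {deg : ∀ q, ℤ → Submodule K (X q)} {d : ∀ q, X (q + 1) →ₗ[K] X q}
  {v : ℕ → ∀ q, X q →ₗ[K] X q}

namespace IsRegularComplex

variable (h : IsRegularComplex n deg d v)
include h

/-- The dimension count in the long exact sequence of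
`0 → X / (v 0, …, v m) X → X / (v 0, …, v (m-1)) X → X / (v 0, …, v m) X → 0`, where the first map
is multiplication by `v m`. -/
lemma finrank_cyc_succ {m : ℕ} (hm : m < n) (q : ℕ) (j : ℤ) :
    Module.finrank K (cyc deg d v (m + 1) q j) +
      Module.finrank K ↥(cyc deg d v m q j ⊓ bdry deg d v (m + 1) (q + 1) j) +
      Module.finrank K (bdry deg d v (m + 1) q (j - 1)) =
    Module.finrank K (bdry deg d v (m + 1) (q + 1) j) + Module.finrank K (cyc deg d v m q j) +
      Module.finrank K (colon deg d v m q j) := by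
  set L := linPart deg v m q j
  set f : X (q + 1) →ₗ[K] X q ⧸ L := L.mkQ ∘ₗ d q
  set g : X q →ₗ[K] X q ⧸ L := L.mkQ ∘ₗ v m q
  have hsup := Submodule.finrank_sup_add_finrank_inf_eq (cyc deg d v m q j)
    (bdry deg d v (m + 1) (q + 1) j)
  have h1 := finrank_add_finrank_map_of_inf_ker_le f
    (sup_le (cyc_mono (m' := m + 1) (Nat.le_succ m) q j) (h.bdry_le_cyc (m + 1) q j)) (by
      rintro x ⟨hx, hx'⟩
      refine Submodule.mem_sup_left ⟨hx.1, ?_⟩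
      simpa [f] using hx')
  have h2 := finrank_add_finrank_map_of_inf_ker_le g (h.bdry_le_colon m q j) (by
      rintro x ⟨hx, hx'⟩
      exact Submodule.mem_sup_right (h.regular hm hx.1 (by simpa [g] using hx')))
  have e1 : (cyc deg d v (m + 1) q j).map f = (colon deg d v m q j).map g := by
    apply le_antisymm
    · rintro _ ⟨x, ⟨hx, hx'⟩, rfl⟩
      obtain ⟨l, hl, _, ⟨u, hu, rfl⟩, hlu⟩ := Submodule.mem_sup.1 hx'
      refine ⟨u, ⟨hu, ?_⟩, ?_⟩
      · rw [SetLike.mem_coe, Submodule.mem_comap, eq_sub_of_add_eq' hlu]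
        exact sub_mem (Submodule.mem_sup_left (Submodule.mem_map_of_mem hx))
          (Submodule.mem_sup_right hl)
      · have : L.mkQ l = 0 := by simpa using hl
        simp only [f, g, LinearMap.comp_apply]
        rw [← hlu, map_add, this, zero_add]
    · rintro _ ⟨u, ⟨hu, hu'⟩, rfl⟩
      obtain ⟨_, ⟨x, hx, rfl⟩, l, hl, hlu⟩ := Submodule.mem_sup.1 hu'
      refine ⟨x, ⟨hx, ?_⟩, ?_⟩
      · rw [SetLike.mem_coe, Submodule.mem_comap, eq_sub_of_add_eq hlu]
        exact sub_mem (v_mem_linPart (Nat.lt_succ_self m) hu)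
          (linPart_mono (Nat.le_succ m) q j hl)
      · have : L.mkQ l = 0 := by simpa using hl
        simp only [f, g, LinearMap.comp_apply]
        rw [← hlu, map_add, this, add_zero]
  have e2 : (cyc deg d v m q j ⊔ bdry deg d v (m + 1) (q + 1) j).map f =
      (bdry deg d v (m + 1) q (j - 1)).map g := by
    apply le_antisymm
    · rw [Submodule.map_sup]
      refine sup_le ?_ ?_
      · rintro _ ⟨x, ⟨-, hx⟩, rfl⟩
        have : f x = 0 := by simpa [f] using hx
        rw [this]
        exact zero_mem _
      · rintro _ ⟨x, hx, rfl⟩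
        obtain ⟨_, ⟨y, hy, rfl⟩, _, hl', rfl⟩ := Submodule.mem_sup.1 hx
        obtain ⟨l, hl, _, ⟨u, hu, rfl⟩, rfl⟩ := Submodule.mem_sup.1 hl'
        refine ⟨d q u, Submodule.mem_sup_left (Submodule.mem_map_of_mem hu), ?_⟩
        have : L.mkQ (d q l) = 0 := by simpa using h.d_mem_linPart hl
        simp only [f, g, LinearMap.comp_apply, map_add, h.d_d, map_zero, zero_add, this, h.d_v]
    · rintro _ ⟨x, hx, rfl⟩
      obtain ⟨_, ⟨y, hy, rfl⟩, _, hl', rfl⟩ := Submodule.mem_sup.1 hx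
      obtain ⟨l, hl, _, ⟨u, hu, rfl⟩, rfl⟩ := Submodule.mem_sup.1 hl'
      refine ⟨v m (q + 1) y, Submodule.mem_sup_right (Submodule.mem_sup_right
        (v_mem_linPart (Nat.lt_succ_self m) hy)), ?_⟩
      have : L.mkQ (v m q l) = 0 := by simpa using h.v_mem_linPart_of_mem m hl
      simp only [f, g, LinearMap.comp_apply, map_add, h.v_sq, map_zero, add_zero, this, h.d_v]
  rw [e1, e2] at h1
  omega

end IsRegularComplex
end

/-- The bound `∑_{p < m} C(m - p - 1 + q, q) a_p`; the binomial coefficient is the number of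
monomials of degree `q` in `m - p` variables. -/
def binomSum (a : ℕ → ℕ) (q m : ℕ) : ℕ :=
  ∑ p ∈ Finset.range m, (m - (p + 1) + q).choose q * a p

lemma binomSum_zero_succ (a : ℕ → ℕ) (m : ℕ) : binomSum a 0 (m + 1) = binomSum a 0 m + a m := by
  simp [binomSum, Finset.sum_range_succ]

lemma binomSum_succ_succ (a : ℕ → ℕ) (q m : ℕ) :
    binomSum a (q + 1) (m + 1) = binomSum a (q + 1) m + binomSum a q (m + 1) := by
  unfold binomSum
  rw [Finset.sum_range_succ, Finset.sum_range_succ,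
    ← add_assoc (∑ p ∈ Finset.range m, (m - (p + 1) + (q + 1)).choose (q + 1) * a p),
    ← Finset.sum_add_distrib]
  congr 1
  · refine Finset.sum_congr rfl fun p hp => ?_
    have hp := Finset.mem_range.1 hp
    rw [← add_mul]
    congr 1
    rw [show m + 1 - (p + 1) + (q + 1) = (m - (p + 1) + (q + 1)) + 1 by omega,
      Nat.choose_succ_succ, show m - (p + 1) + (q + 1) = m + 1 - (p + 1) + q by omega, add_comm]
  · simp

/-- If numbers `h` satisfy the recursion of `binomSum` up to nonnegative errors `r` and `s`, then
equality with `binomSum` at one place with `i ≥ 1` forces the errors with first index `0` to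
vanish. -/
lemma errors_eq_zero_of_eq_binomSum {n : ℕ} {h r s : ℕ → ℕ → ℕ} {a : ℕ → ℕ} (h0 : ∀ q, h q 0 = 0)
    (h1 : ∀ m < n, h 0 (m + 1) + r 0 m = h 0 m + a m)
    (h2 : ∀ q, ∀ m < n,
      h (q + 1) (m + 1) + r (q + 1) m + s q m = h (q + 1) m + h q (m + 1))
    {i : ℕ} (hi : h (i + 1) n = binomSum a (i + 1) n) : ∀ m < n, r 0 m = 0 ∧ s 0 m = 0 := by
  have hz : ∀ q, binomSum a q 0 = 0 := fun q => by simp [binomSum]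
  have hle : ∀ q, ∀ m ≤ n, h q m ≤ binomSum a q m := by
    intro q
    induction q with
    | zero =>
      intro m
      induction m with
      | zero => simp [h0]
      | succ m ih =>
        intro hm
        have := h1 m hm
        have := ih (by omega)
        rw [binomSum_zero_succ]
        omega
    | succ q ihq =>
      intro m
      induction m with
      | zero => simp [h0]
      | succ m ih =>
        intro hm
        have := h2 q m hm
        have := ih (by omega)
        have := ihq (m + 1) hm
        rw [binomSum_succ_succ]
        omega
  have hdown : ∀ q, h (q + 1) n = binomSum a (q + 1) n → ∀ t m, m + t = n →
      h (q + 1) m = binomSum a (q + 1) m := by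
    intro q hq t
    induction t with
    | zero => rintro m rfl; exact hq
    | succ t ih =>
      intro m hm
      have e := ih (m + 1) (by omega)
      have := h2 q m (by omega)
      have := hle (q + 1) m (by omega)
      have := hle q (m + 1) (by omega)
      rw [binomSum_succ_succ] at e
      omega
  have hstep : ∀ q, h (q + 1) n = binomSum a (q + 1) n →
      ∀ m < n, h q (m + 1) = binomSum a q (m + 1) ∧ s q m = 0 := by
    intro q hq m hm
    have e1 := hdown q hq (n - m) m (by omega)
    have e2 := hdown q hq (n - (m + 1)) (m + 1) (by omega)
    have := h2 q m hm
    have := hle q (m + 1) hm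
    rw [binomSum_succ_succ] at e2
    omega
  have hred : h 1 n = binomSum a 1 n := by
    induction i with
    | zero => exact hi
    | succ i ih =>
      refine ih ?_
      rcases n with _ | n
      · rw [h0, hz]
      · exact (hstep _ hi n (by omega)).1
  intro m hm
  have hs := hstep 0 hred
  refine ⟨?_, (hs m hm).2⟩
  have e1 := (hs m hm).1
  have e2 : h 0 m = binomSum a 0 m := by
    rcases m with _ | m
    · rw [h0, hz]
    · exact (hs m (by omega)).1
  have := h1 m hm
  rw [binomSum_zero_succ] at e1
  omega

/-- If all errors in the recursion vanish, then `h` is `binomSum`. -/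
lemma eq_binomSum_of_errors_eq_zero {n : ℕ} {h r s : ℕ → ℕ → ℕ} {a : ℕ → ℕ}
    (h0 : ∀ q, h q 0 = 0)
    (h1 : ∀ m < n, h 0 (m + 1) + r 0 m = h 0 m + a m)
    (h2 : ∀ q, ∀ m < n,
      h (q + 1) (m + 1) + r (q + 1) m + s q m = h (q + 1) m + h q (m + 1))
    (hr : ∀ q, ∀ m < n, r q m = 0) (hs : ∀ q, ∀ m < n, s q m = 0) (q : ℕ) :
    ∀ m ≤ n, h q m = binomSum a q m := by
  induction q with
  | zero =>
    intro m
    induction m with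
    | zero => simp [h0, binomSum]
    | succ m ih =>
      intro hm
      have := h1 m hm
      rw [binomSum_zero_succ, ← ih (by omega), ← this, hr 0 m hm, add_zero]
  | succ q ihq =>
    intro m
    induction m with
    | zero => simp [h0, binomSum]
    | succ m ih =>
      intro hm
      have := h2 q m hm
      rw [binomSum_succ_succ, ← ih (by omega), ← ihq (m + 1) hm, ← this, hr _ m hm, hs _ m hm,
        add_zero, add_zero]

section
variable {K : Type*} [Field K] {X : ℕ → Type*} [∀ q, AddCommGroup (X q)] [∀ q, Module K (X q)]
  [∀ q, Module.Finite K (X q)]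
variable {n : ℕ} {deg : ∀ q, ℤ → Submodule K (X q)} {d : ∀ q, X (q + 1) →ₗ[K] X q}
  {v : ℕ → ∀ q, X q →ₗ[K] X q}

/-- Rigidity for the homology of `X / (v 0, …, v (n-1)) X`: if its dimension along the strand `k`
attains the bound given by the annihilator numbers `a` in one homological degree at least two, then
it does so in every positive homological degree. -/
theorem IsRegularComplex.finrank_homology_eq (h : IsRegularComplex n deg d v) (k : ℤ) {a : ℕ → ℕ}
    (ha : ∀ m < n, Module.finrank K (colon deg d v m 0 (k + 1)) =
      a m + Module.finrank K (bdry deg d v (m + 1) 0 k)) {i : ℕ}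
    (hi : Module.finrank K (cyc deg d v n (i + 1) (k + (i + 1 : ℕ) + 1)) -
      Module.finrank K (bdry deg d v n (i + 2) (k + (i + 1 : ℕ) + 1)) = binomSum a (i + 1) n)
    (q : ℕ) : Module.finrank K (cyc deg d v n q (k + q + 1)) -
      Module.finrank K (bdry deg d v n (q + 1) (k + q + 1)) = binomSum a q n := by
  -- `hh` is the dimension of homology, `r` and `s` are the ranks of the multiplications by `v m`
  -- at the two ends of a five-term piece of the long exact sequence.
  set hh : ℕ → ℕ → ℕ := fun q m => Module.finrank K (cyc deg d v m q (k + q + 1)) -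
    Module.finrank K (bdry deg d v m (q + 1) (k + q + 1)) with hh_def
  set r : ℕ → ℕ → ℕ := fun q m =>
    Module.finrank K ↥(cyc deg d v m q (k + q + 1) ⊓ bdry deg d v (m + 1) (q + 1) (k + q + 1)) -
    Module.finrank K (bdry deg d v m (q + 1) (k + q + 1)) with r_def
  set s : ℕ → ℕ → ℕ := fun q m => Module.finrank K (cyc deg d v (m + 1) q (k + q + 1)) -
    Module.finrank K (colon deg d v m (q + 1) (k + q + 1 + 1)) with s_def
  have hbc : ∀ m q, Module.finrank K (bdry deg d v m (q + 1) (k + q + 1)) ≤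
      Module.finrank K (cyc deg d v m q (k + q + 1)) := fun m q =>
    Submodule.finrank_mono (h.bdry_le_cyc m q _)
  have hbr : ∀ m q, bdry deg d v m (q + 1) (k + q + 1) ≤
      cyc deg d v m q (k + q + 1) ⊓ bdry deg d v (m + 1) (q + 1) (k + q + 1) := fun m q =>
    le_inf (h.bdry_le_cyc m q _) (bdry_mono (Nat.le_succ m) _ _)
  have hcc : ∀ m < n, ∀ q, colon deg d v m (q + 1) (k + q + 1 + 1) ≤
      cyc deg d v (m + 1) q (k + q + 1) := fun m hm q => by
    simpa using h.colon_le_cyc hm q (k + q + 1 + 1)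
  have hbr' := fun m q => Submodule.finrank_mono (hbr m q)
  have hcc' := fun m hm q => Submodule.finrank_mono (hcc m hm q)
  have h0 : ∀ q, hh q 0 = 0 := by
    intro q
    refine Nat.sub_eq_zero_of_le (Submodule.finrank_mono ?_)
    rintro x ⟨hx, hx'⟩
    obtain ⟨y, hy, rfl⟩ := h.exact hx (by simpa [linPart] using hx')
    exact Submodule.mem_sup_left (Submodule.mem_map_of_mem hy)
  have h1 : ∀ m < n, hh 0 (m + 1) + r 0 m = hh 0 m + a m := by
    intro m hm
    have e := h.finrank_cyc_succ hm 0 (k + (0 : ℕ) + 1)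
    have e' := ha m hm
    have := hbc m 0
    have := hbc (m + 1) 0
    have := hbr' m 0
    simp only [hh_def, r_def]
    rw [show k + ((0 : ℕ) : ℤ) + 1 = k + 1 by simp] at *
    rw [add_sub_cancel_right] at e
    omega
  have h2 : ∀ q, ∀ m < n,
      hh (q + 1) (m + 1) + r (q + 1) m + s q m = hh (q + 1) m + hh q (m + 1) := by
    intro q m hm
    have e := h.finrank_cyc_succ hm (q + 1) (k + (q + 1 : ℕ) + 1)
    have := hbc m (q + 1)
    have := hbc (m + 1) (q + 1)
    have := hbc (m + 1) q
    have := hbr' m (q + 1)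
    have := hcc' m hm q
    simp only [hh_def, r_def, s_def]
    rw [add_sub_cancel_right] at e
    rw [show k + ((q + 1 : ℕ) : ℤ) = k + q + 1 by push_cast; ring] at *
    omega
  have hr_iff : ∀ q, ∀ m < n, (r q m = 0 ↔
      cyc deg d v (m + 1) q (k + q) ≤ colon deg d v m (q + 1) (k + q + 1)) := by
    intro q m hm
    have e := h.cyc_inf_bdry_le_iff hm q (k + q + 1)
    rw [add_sub_cancel_right] at e
    rw [← e]
    refine ⟨fun e => (Submodule.eq_of_le_of_finrank_le (hbr m q) ?_).ge, fun e => ?_⟩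
    · exact Nat.sub_eq_zero_iff_le.1 e
    · exact Nat.sub_eq_zero_of_le (Submodule.finrank_mono e)
  have hs_iff : ∀ q, ∀ m < n, (s q m = 0 ↔
      cyc deg d v (m + 1) q (k + q + 1) ≤ colon deg d v m (q + 1) (k + q + 1 + 1)) := by
    intro q m hm
    refine ⟨fun e => (Submodule.eq_of_le_of_finrank_le (hcc m hm q) ?_).ge, fun e => ?_⟩
    · exact Nat.sub_eq_zero_iff_le.1 e
    · exact Nat.sub_eq_zero_of_le (Submodule.finrank_mono e)
  have hz := errors_eq_zero_of_eq_binomSum h0 h1 h2 hi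
  have hr : ∀ q, ∀ m < n, r q m = 0 := by
    intro q
    induction q with
    | zero => exact fun m hm => (hz m hm).1
    | succ q ih =>
      intro m hm
      have := h.cyc_le_colon_succ (q := q) (j := k + q + 1)
        (fun m hm => by simpa using (hr_iff q m hm).1 (ih m hm)) m hm
      rw [hr_iff _ m hm]
      simpa [add_assoc] using this
  have hs : ∀ q, ∀ m < n, s q m = 0 := by
    intro q
    induction q with
    | zero => exact fun m hm => (hz m hm).2
    | succ q ih =>
      intro m hm
      have := h.cyc_le_colon_succ (q := q) (j := k + q + 1 + 1)
        (fun m hm => by simpa using (hs_iff q m hm).1 (ih m hm)) m hm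
      rw [hs_iff _ m hm]
      simpa [add_assoc] using this
  exact eq_binomSum_of_errors_eq_zero h0 h1 h2 hr hs q n le_rfl

end

/-! ### Homogeneous components -/

section
variable {K : Type u} [Field K] {N N' : Type*} [AddCommGroup N] [Module K N] [AddCommGroup N']
  [Module K N']

/-- The projection of a `ℤ`-graded vector space to its homogeneous component of degree `j`, as an
endomorphism. -/
noncomputable def homComponent {𝒩 : ℤ → Submodule K N} (h : DirectSum.IsInternal 𝒩) (j : ℤ) :
    N →ₗ[K] N :=
  (𝒩 j).subtype ∘ₗ DirectSum.component K ℤ (fun i => 𝒩 i) j ∘ₗ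
    (LinearEquiv.ofBijective (DirectSum.coeLinearMap 𝒩) h).symm.toLinearMap

variable {𝒩 : ℤ → Submodule K N} (h : DirectSum.IsInternal 𝒩) {𝒩' : ℤ → Submodule K N'}
  (h' : DirectSum.IsInternal 𝒩')

lemma homComponent_mem (j : ℤ) (x : N) : homComponent h j x ∈ 𝒩 j :=
  Submodule.coe_mem _

lemma homComponent_of_mem (i j : ℤ) (x : N) (hx : x ∈ 𝒩 i) :
    homComponent h j x = if i = j then x else 0 := by
  have : (LinearEquiv.ofBijective (DirectSum.coeLinearMap 𝒩) h).symm x =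
      DirectSum.lof K ℤ (fun i => 𝒩 i) i ⟨x, hx⟩ := by
    rw [LinearEquiv.symm_apply_eq]
    exact (DirectSum.coeLinearMap_lof 𝒩 i ⟨x, hx⟩).symm
  simp only [homComponent, LinearMap.comp_apply, LinearEquiv.coe_coe, this]
  split_ifs with hij
  · subst hij
    rw [DirectSum.component.lof_self]
    rfl
  · rw [DirectSum.component.of, dif_neg hij, map_zero]

lemma homComponent_map (f : N →ₗ[K] N') (c : ℤ) (hf : ∀ j, ∀ x ∈ 𝒩 j, f x ∈ 𝒩' (j + c)) (j : ℤ)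
    (x : N) : f (homComponent h j x) = homComponent h' (j + c) (f x) := by
  have hx : x ∈ iSup 𝒩 := by rw [h.submodule_iSup_eq_top]; trivial
  refine Submodule.iSup_induction 𝒩
    (motive := fun x => f (homComponent h j x) = homComponent h' (j + c) (f x)) hx ?_ (by simp)
    fun x y hx hy => by simp [hx, hy]
  intro i x hx
  rw [homComponent_of_mem h i j x hx, homComponent_of_mem h' _ _ _ (hf i x hx)]
  by_cases hij : i = j <;> simp [hij]

/-- `dimMod A B` computed upstairs, from preimages of `A` and `A ∩ B` under `p`. -/
lemma finrank_eq_dimMod_add_finrank [Module.Finite K N] (p : N →ₗ[K] N') {Z Z' : Submodule K N}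
    {A B : Submodule K N'} (hA : Z.map p = A) (hle : Z' ≤ Z) (hB : ∀ x ∈ Z, p x ∈ B ↔ x ∈ Z') :
    Module.finrank K Z = dimMod A B + Module.finrank K Z' := by
  subst hA
  have h1 := Submodule.finrank_quotient_add_finrank (B.submoduleOf (Z.map p))
  have h2 := finrank_add_finrank_map_of_inf_ker_le p hle (by
    rintro x ⟨hx, hx'⟩
    rw [← hB x hx, LinearMap.mem_ker.1 hx']
    exact zero_mem _)
  have h3 : Module.finrank K (B.submoduleOf (Z.map p)) = Module.finrank K (Z'.map p) := by
    rw [← Submodule.finrank_map_subtype_eq, Submodule.submoduleOf, Submodule.map_comap_subtype]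
    suffices Z.map p ⊓ B = Z'.map p by rw [this]
    ext y
    constructor
    · rintro ⟨⟨x, hx, rfl⟩, hy⟩
      exact ⟨x, (hB x hx).1 hy, rfl⟩
    · rintro ⟨x, hx, rfl⟩
      exact ⟨⟨x, hle hx, rfl⟩, (hB x (hle hx)).2 hx⟩
  unfold dimMod
  omega

end

/-! ### Regularity of linear forms on free modules -/

section
variable {K : Type u} [Field K] {V : Type v} [AddCommGroup V] [Module K V]

lemma ι_mem_extDeg (x : V) : ExteriorAlgebra.ι K x ∈ extDeg K V 1 := by
  simp [extDeg]

lemma contractLeft_mem_extDeg (φ : Module.Dual K V) {j : ℤ} {x : ExteriorAlgebra K V}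
    (hx : x ∈ extDeg K V j) : CliffordAlgebra.contractLeft φ x ∈ extDeg K V (j - 1) := by
  have key : ∀ m : ℕ, ∀ x ∈ ⋀[K]^m V,
      CliffordAlgebra.contractLeft φ x ∈ extDeg K V ((m : ℤ) - 1) := by
    intro m
    induction m with
    | zero =>
      intro x hx
      rw [ExteriorAlgebra.exteriorPower, pow_zero, Submodule.mem_one] at hx
      obtain ⟨c, rfl⟩ := hx
      rw [CliffordAlgebra.contractLeft_algebraMap]
      exact zero_mem _
    | succ m ih =>
      intro x hx
      rw [ExteriorAlgebra.exteriorPower, pow_succ'] at hx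
      induction hx using Submodule.mul_induction_on' with
      | mem_mul_mem y hy z hz =>
        obtain ⟨y, rfl⟩ := hy
        have hz' : z ∈ extDeg K V m := by simpa [extDeg] using hz
        have e : CliffordAlgebra.contractLeft φ (ExteriorAlgebra.ι K y * z) =
          φ y • z - ExteriorAlgebra.ι K y * CliffordAlgebra.contractLeft φ z :=
          CliffordAlgebra.contractLeft_ι_mul φ y z
        rw [e, Nat.cast_succ, add_sub_cancel_right]
        refine sub_mem (Submodule.smul_mem _ _ hz') ?_
        simpa using extDeg_mul (ι_mem_extDeg y) (ih z hz)
      | add y _ z _ hy hz => rw [map_add]; exact add_mem hy hz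
  by_cases hj : 0 ≤ j
  · have := key j.toNat x (by simpa [extDeg, hj] using hx)
    rwa [Int.toNat_of_nonneg hj] at this
  · have : x = 0 := by simpa [extDeg, hj] using hx
    rw [this, map_zero]
    exact zero_mem _

/-- Contraction with a linear functional, coordinatewise on a free module over the exterior
algebra. -/
noncomputable def freeContract (φ : Module.Dual K V) (r : ℕ) :
    (Fin r → ExteriorAlgebra K V) →ₗ[K] (Fin r → ExteriorAlgebra K V) :=
  (CliffordAlgebra.contractLeft φ : ExteriorAlgebra K V →ₗ[K] ExteriorAlgebra K V).compLeft (Fin r)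

lemma freeContract_ι_smul (φ : Module.Dual K V) {r : ℕ} (w : V)
    (x : Fin r → ExteriorAlgebra K V) : freeContract φ r (ExteriorAlgebra.ι K w • x) =
      φ w • x - ExteriorAlgebra.ι K w • freeContract φ r x := by
  funext i
  exact CliffordAlgebra.contractLeft_ι_mul φ w (x i)

lemma freeContract_mem (φ : Module.Dual K V) {r : ℕ} {deg : Fin r → ℤ} {j : ℤ}
    {x : Fin r → ExteriorAlgebra K V} (hx : x ∈ freeDeg (K := K) deg j) :
    freeContract φ r x ∈ freeDeg (K := K) deg (j - 1) := by
  intro i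
  have := contractLeft_mem_extDeg φ (hx i)
  rwa [sub_right_comm] at this

/-- A basis `b` of `V` as a sequence, continued by zero. -/
noncomputable def basisSeq {n : ℕ} (b : Module.Basis (Fin n) K V) (a : ℕ) : V :=
  if h : a < n then b ⟨a, h⟩ else 0

lemma basisSeq_coe {n : ℕ} (b : Module.Basis (Fin n) K V) (a : Fin n) :
    basisSeq b a = b a := by simp [basisSeq]

/-- Multiplication by the linear form `b a` on a module over the exterior algebra, as a `K`-linear
map; it is zero for `a ≥ n`. -/
noncomputable def basisMul {n : ℕ} (b : Module.Basis (Fin n) K V) (N : Type*) [AddCommGroup N]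
    [Module K N] [Module (ExteriorAlgebra K V) N] [IsScalarTower K (ExteriorAlgebra K V) N]
    (a : ℕ) : N →ₗ[K] N :=
  Algebra.lsmul K K N (ExteriorAlgebra.ι K (basisSeq b a))

section
variable {N : Type*} [AddCommGroup N] [Module K N] [Module (ExteriorAlgebra K V) N]
  [IsScalarTower K (ExteriorAlgebra K V) N]

lemma basisMul_apply {n : ℕ} (b : Module.Basis (Fin n) K V) (a : ℕ) (x : N) :
    basisMul b N a x = ExteriorAlgebra.ι K (basisSeq b a) • x := rfl

lemma mem_linMul_iff {n m : ℕ} (b : Module.Basis (Fin n) K V) (hm : m ≤ n) {y : N} :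
    y ∈ linMul K N b m ↔ ∃ x : ℕ → N, y = ∑ a ∈ Finset.range m, basisMul b N a (x a) := by
  constructor
  · intro hy
    have hy : y ∈ (linMul K N b m).restrictScalars K := hy
    rw [← range_linMap] at hy
    obtain ⟨x, rfl⟩ := hy
    refine ⟨fun a => if h : a < n then x ⟨a, h⟩ else 0, ?_⟩
    have hf : Finset.range m = (Finset.range n).filter (· < m) := by
      ext a
      simp only [Finset.mem_range, Finset.mem_filter]
      omega
    rw [hf, Finset.sum_filter, Finset.sum_range, linMap, LinearMap.sum_apply]
    refine Finset.sum_congr rfl fun a _ => ?_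
    split_ifs <;> simp [basisMul_apply, basisSeq_coe]
  · rintro ⟨x, rfl⟩
    refine Submodule.sum_mem _ fun a ha => ?_
    have ha := Finset.mem_range.1 ha
    exact Submodule.subset_span ⟨⟨a, by omega⟩, ha, x a, by
      rw [basisMul_apply, ← basisSeq_coe b]⟩

/-- `E₊ N = V N`. -/
lemma mem_augSub_iff {n : ℕ} (b : Module.Basis (Fin n) K V) {y : N} :
    y ∈ augSub K V N ↔ y ∈ linMul K N b n := by
  have key : ∀ (a : ExteriorAlgebra K V) (x : N),
      (a - algebraMap K _ (ExteriorAlgebra.algebraMapInv a)) • x ∈ linMul K N b n := by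
    intro a
    induction a using ExteriorAlgebra.induction with
    | algebraMap c =>
      intro x
      rw [ExteriorAlgebra.algebraMap_leftInverse, sub_self, zero_smul]
      exact zero_mem _
    | ι w =>
      intro x
      have h0 : ExteriorAlgebra.algebraMapInv (ExteriorAlgebra.ι K w) = (0 : K) := by
        simp [ExteriorAlgebra.algebraMapInv]
      rw [h0, map_zero, sub_zero, ← b.sum_repr w]
      simp only [map_sum, map_smul, Finset.sum_smul, smul_assoc]
      refine Submodule.sum_mem _ fun a _ => ?_
      exact ((linMul K N b n).restrictScalars K).smul_mem _
        (Submodule.subset_span ⟨a, a.2, x, rfl⟩)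
    | mul a c ha hc =>
      intro x
      have e : (a * c - algebraMap K (ExteriorAlgebra K V) (ExteriorAlgebra.algebraMapInv (a * c)))
          • x = a • (c - algebraMap K _ (ExteriorAlgebra.algebraMapInv c)) • x +
            (a - algebraMap K _ (ExteriorAlgebra.algebraMapInv a)) •
              algebraMap K (ExteriorAlgebra K V) (ExteriorAlgebra.algebraMapInv c) • x := by
        rw [smul_smul, smul_smul, ← add_smul, map_mul, map_mul]
        congr 1
        noncomm_ring
      rw [e]
      exact add_mem (Submodule.smul_mem _ _ (hc x)) (ha _)
    | add a c ha hc =>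
      intro x
      rw [map_add, map_add, add_sub_add_comm, add_smul]
      exact add_mem (ha x) (hc x)
  constructor
  · intro hy
    refine Submodule.span_le.2 ?_ hy
    rintro _ ⟨a, ha, x, rfl⟩
    have := key a x
    rwa [RingHom.mem_ker.1 ha, map_zero, sub_zero] at this
  · intro hy
    refine Submodule.span_le.2 ?_ hy
    rintro _ ⟨a, -, x, rfl⟩
    exact Submodule.subset_span ⟨_, by
      simp [RingHom.mem_ker, ExteriorAlgebra.algebraMapInv], x, rfl⟩

end

namespace GradedFreeResolution

variable {M : Type w} [AddCommGroup M] [Module K M] [Module (ExteriorAlgebra K V) M]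
  {ℳ : ℤ → Submodule K M} (F : GradedFreeResolution V ℳ) {n : ℕ} (b : Module.Basis (Fin n) K V)

/-- The underlying module of `F_q`. -/
abbrev Free (q : ℕ) : Type _ := Fin (F.rank q) → ExteriorAlgebra K V

/-- The degree `j` part of `F_q`. -/
abbrev gr (q : ℕ) (j : ℤ) : Submodule K (F.Free q) := freeDeg (F.deg q) j

/-- The differential of `F` as a `K`-linear map. -/
abbrev dK (q : ℕ) : F.Free (q + 1) →ₗ[K] F.Free q := (F.d q).restrictScalars K

/-- Multiplication by the linear form `b a` on `F_q`. -/
noncomputable abbrev mulB (a q : ℕ) : F.Free q →ₗ[K] F.Free q := basisMul b (F.Free q) a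

lemma isInternal_gr (q : ℕ) : DirectSum.IsInternal (F.gr q) := (freeDeg_isGraded (F.deg q)).internal

lemma mulB_mem (a q : ℕ) {j : ℤ} {x : F.Free q} (hx : x ∈ F.gr q j) :
    F.mulB b a q x ∈ F.gr q (j + 1) := by
  rw [add_comm]
  exact (freeDeg_isGraded (F.deg q)).smul_mem _ _ _ _ (ι_mem_extDeg _) hx

lemma isRegularComplex : IsRegularComplex n F.gr F.dK (F.mulB b) where
  d_mem hx := F.d_mem _ _ _ hx
  v_mem hx := by simpa using F.mulB_mem b _ _ hx
  d_v a q x := map_smul (F.d q) _ x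
  v_v a c q x := by
    rw [eq_neg_iff_add_eq_zero]
    simp only [basisMul_apply, smul_smul]
    rw [← add_smul, ExteriorAlgebra.ι_add_mul_swap, zero_smul]
  v_sq a q x := by
    simp only [basisMul_apply, smul_smul]
    rw [ExteriorAlgebra.ι_sq_zero, zero_smul]
  d_d q x := by
    have : F.d (q + 1) x ∈ LinearMap.ker (F.d q) := by
      rw [← F.range_d_succ q]
      exact ⟨x, rfl⟩
    exact this
  exact := by
    intro q j x hx h0
    have hk : x ∈ LinearMap.range (F.d (q + 1)) := by
      rw [F.range_d_succ q]
      exact h0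
    obtain ⟨y, rfl⟩ := hk
    refine ⟨homComponent (F.isInternal_gr (q + 2)) j y, homComponent_mem _ _ _, ?_⟩
    rw [homComponent_map _ (F.isInternal_gr (q + 1)) (F.dK (q + 1)) 0
      (fun j x hx => by simpa using F.d_mem _ _ _ hx), add_zero]
    exact (homComponent_of_mem _ j j _ hx).trans (if_pos rfl)
  regular := by
    intro m q j x hm hx hx'
    -- Contraction with the functional dual to `b m` recovers `x` up to `(b 0, …, b m) F`.
    obtain ⟨w, hw, e⟩ := mem_linPart_iff.1 hx'
    set c := freeContract (b.coord ⟨m, hm⟩) (F.rank q)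
    have hc := congrArg c e
    have h1 : b.coord ⟨m, hm⟩ (basisSeq b m) = 1 := by simp [basisSeq, hm]
    rw [basisMul_apply, freeContract_ι_smul, h1, one_smul, map_sum] at hc
    have hc' : ∑ a ∈ Finset.range m, c (F.mulB b a q (w a)) =
        ∑ a ∈ Finset.range m, F.mulB b a q (- c (w a)) := by
      refine Finset.sum_congr rfl fun a ha => ?_
      have ha := Finset.mem_range.1 ha
      have h0 : b.coord ⟨m, hm⟩ (basisSeq b a) = 0 := by
        simp [basisSeq, ha.trans hm, ha.ne]
      rw [basisMul_apply, freeContract_ι_smul, h0, zero_smul, zero_sub, map_neg, basisMul_apply]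
    rw [hc'] at hc
    rw [eq_add_of_sub_eq hc]
    exact Submodule.add_mem_sup
      (mem_linPart_iff.2 ⟨_, fun a => neg_mem (freeContract_mem _ (hw a)), rfl⟩)
      (Submodule.mem_map_of_mem (freeContract_mem _ hx))

lemma linPart_le_linMul {m : ℕ} (hm : m ≤ n) (q : ℕ) (j : ℤ) :
    linPart F.gr (F.mulB b) m q j ≤ (linMul K (F.Free q) b m).restrictScalars K := by
  intro x hx
  obtain ⟨w, -, rfl⟩ := mem_linPart_iff.1 hx
  exact (mem_linMul_iff b hm).2 ⟨w, rfl⟩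

/-- A homogeneous element of `d F_{q+1} + I_m F_q` lies in `bdry`; the summands need not be
homogeneous. -/
lemma mem_bdry_of_eq {m : ℕ} (hm : m ≤ n) {q : ℕ} {j : ℤ} {x l : F.Free q} (hx : x ∈ F.gr q j)
    (y : F.Free (q + 1)) (hl : l ∈ linMul K (F.Free q) b m) (e : x = F.d q y + l) :
    x ∈ bdry F.gr F.dK (F.mulB b) m q j := by
  obtain ⟨w, rfl⟩ := (mem_linMul_iff b hm).1 hl
  have hx' := (homComponent_of_mem (F.isInternal_gr q) j j x hx).trans (if_pos rfl)
  rw [← hx', e, map_add, map_sum]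
  refine Submodule.add_mem_sup
    ⟨homComponent (F.isInternal_gr (q + 1)) j y, homComponent_mem _ _ _, ?_⟩
    (mem_linPart_iff.2 ⟨fun a => homComponent (F.isInternal_gr q) (j - 1) (w a),
      fun a => homComponent_mem _ _ _, Finset.sum_congr rfl fun a _ => ?_⟩)
  · rw [homComponent_map _ (F.isInternal_gr q) (F.dK q) 0
      (fun j x hx => by simpa using F.d_mem _ _ _ hx), add_zero]
    rfl
  · rw [homComponent_map _ (F.isInternal_gr q) (F.mulB b a q) 1
      (fun j x hx => F.mulB_mem b a q hx), sub_add_cancel]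

lemma mem_linPart_of_mem_linMul {m : ℕ} (hm : m ≤ n) {q : ℕ} {j : ℤ} {x : F.Free q}
    (hx : x ∈ F.gr q j) (hl : x ∈ linMul K (F.Free q) b m) :
    x ∈ linPart F.gr (F.mulB b) m q j := by
  obtain ⟨w, e⟩ := (mem_linMul_iff b hm).1 hl
  have hx' := (homComponent_of_mem (F.isInternal_gr q) j j x hx).trans (if_pos rfl)
  rw [← hx', e, map_sum]
  refine mem_linPart_iff.2 ⟨fun a => homComponent (F.isInternal_gr q) (j - 1) (w a),
      fun a => homComponent_mem _ _ _, Finset.sum_congr rfl fun a _ => ?_⟩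
  rw [homComponent_map _ (F.isInternal_gr q) (F.mulB b a q) 1
      (fun j x hx => F.mulB_mem b a q hx), sub_add_cancel]

/-- Since `K ⊗ F = F / (b 0, …, b (n-1)) F`, graded Betti numbers are the dimensions of the
homology of this quotient. -/
lemma finrank_cyc_eq_betti_add [Module.Finite K V] (q : ℕ) (j : ℤ) :
    Module.finrank K (cyc F.gr F.dK (F.mulB b) n q j) =
      F.betti (q + 1) j + Module.finrank K (bdry F.gr F.dK (F.mulB b) n (q + 1) j) := by
  have hreg := F.isRegularComplex b
  refine finrank_eq_dimMod_add_finrank ((augSub K V (F.Free (q + 1))).mkQ.restrictScalars K) ?_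
    (hreg.bdry_le_cyc n q j) ?_
  · have hker : ∀ x, (augSub K V (F.Free (q + 1))).mkQ x ∈ LinearMap.ker (F.tensD q) ↔
        F.d q x ∈ augSub K V (F.Free q) := fun x => by
      rw [LinearMap.mem_ker, ← Submodule.Quotient.mk_eq_zero]
      rfl
    apply le_antisymm
    · rintro _ ⟨x, ⟨hx, hx'⟩, rfl⟩
      exact ⟨(hker x).2 ((mem_augSub_iff b).2 (F.linPart_le_linMul b le_rfl q j hx')), x, hx, rfl⟩
    · rintro _ ⟨hy, x, hx, rfl⟩
      exact ⟨x, ⟨hx, F.mem_linPart_of_mem_linMul b le_rfl (F.d_mem _ _ _ hx)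
        ((mem_augSub_iff b).1 ((hker x).1 hy))⟩, rfl⟩
  · rintro x ⟨hx, -⟩
    constructor
    · rintro ⟨y, hy⟩
      obtain ⟨y, rfl⟩ := Submodule.mkQ_surjective _ y
      have : F.d (q + 1) y - x ∈ augSub K V (F.Free (q + 1)) := (Submodule.Quotient.eq _).1 hy
      refine F.mem_bdry_of_eq b le_rfl hx y (l := -(F.d (q + 1) y - x))
        (neg_mem ((mem_augSub_iff b).1 this)) (by abel)
    · intro hx
      obtain ⟨_, ⟨y, -, rfl⟩, l, hl, rfl⟩ := Submodule.mem_sup.1 hx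
      refine ⟨(augSub K V (F.Free (q + 2))).mkQ y, ?_⟩
      refine (Submodule.Quotient.eq _).2 ?_
      have : l ∈ augSub K V (F.Free (q + 1)) :=
        (mem_augSub_iff b).2 (F.linPart_le_linMul b le_rfl _ j hl)
      simpa using this

variable [IsScalarTower K (ExteriorAlgebra K V) M]

lemma ε_mem_linMul_iff {m : ℕ} (hm : m ≤ n) {j : ℤ} {x : F.Free 0} (hx : x ∈ F.gr 0 j) :
    F.ε x ∈ linMul K M b m ↔ x ∈ bdry F.gr F.dK (F.mulB b) m 0 j := by
  constructor
  · intro h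
    obtain ⟨w, hw⟩ := (mem_linMul_iff b hm).1 h
    choose u hu using fun y => LinearMap.range_eq_top.1 F.range_ε y
    have hk : x - ∑ a ∈ Finset.range m, F.mulB b a 0 (u (w a)) ∈ LinearMap.range (F.d 0) := by
      rw [F.range_d_zero, LinearMap.mem_ker, map_sub, hw, map_sum, sub_eq_zero]
      refine Finset.sum_congr rfl fun a _ => ?_
      rw [basisMul_apply, basisMul_apply, map_smul, hu]
    obtain ⟨y, hy⟩ := hk
    exact F.mem_bdry_of_eq b hm hx y ((mem_linMul_iff b hm).2 ⟨_, rfl⟩) (eq_add_of_sub_eq hy.symm)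
  · intro h
    obtain ⟨_, ⟨y, -, rfl⟩, l, hl, rfl⟩ := Submodule.mem_sup.1 h
    obtain ⟨w, -, rfl⟩ := mem_linPart_iff.1 hl
    have h0 : F.ε (F.d 0 y) = 0 := by
      have : F.d 0 y ∈ LinearMap.ker F.ε := by
        rw [← F.range_d_zero]
        exact ⟨y, rfl⟩
      exact this
    refine (mem_linMul_iff b hm).2 ⟨fun a => F.ε (w a), ?_⟩
    rw [map_add, LinearMap.restrictScalars_apply, h0, zero_add, map_sum]
    exact Finset.sum_congr rfl fun a _ => map_smul F.ε _ _

lemma exists_ε_eq (hM : IsGraded V ℳ) {j : ℤ} {y : M} (hy : y ∈ ℳ j) :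
    ∃ x ∈ F.gr 0 j, F.ε x = y := by
  obtain ⟨x, rfl⟩ := LinearMap.range_eq_top.1 F.range_ε y
  refine ⟨homComponent (F.isInternal_gr 0) j x, homComponent_mem _ _ _, ?_⟩
  have := homComponent_map (F.isInternal_gr 0) hM.internal (F.ε.restrictScalars K) 0
    (fun j x hx => by simpa using F.ε_mem j x hx) j x
  rw [add_zero] at this
  exact this.trans ((homComponent_of_mem _ j j _ hy).trans (if_pos rfl))

lemma finrank_colon_eq_annNumber_add [Module.Finite K V] (hM : IsGraded V ℳ) (p : Fin n) (k : ℤ) :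
    Module.finrank K (colon F.gr F.dK (F.mulB b) p 0 (k + 1)) =
      annNumber ℳ b p k + Module.finrank K (bdry F.gr F.dK (F.mulB b) (p + 1) 0 k) := by
  have hreg := F.isRegularComplex b
  have hcolon : ∀ x ∈ F.gr 0 k, F.ε x ∈ colonLin K M b p ↔
      x ∈ colon F.gr F.dK (F.mulB b) p 0 (k + 1) := by
    intro x hx
    have e : F.ε (F.mulB b p 0 x) = ExteriorAlgebra.ι K (b p) • F.ε x := by
      rw [basisMul_apply, map_smul, basisSeq_coe]
    have h1 := F.ε_mem_linMul_iff b p.2.le (F.mulB_mem b p 0 hx)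
    rw [e] at h1
    refine Iff.trans h1 ⟨fun h => ⟨by simpa using hx, h⟩, fun h => h.2⟩
  refine finrank_eq_dimMod_add_finrank (F.ε.restrictScalars K) ?_ ?_ ?_
  · apply le_antisymm
    · rintro _ ⟨x, hx, rfl⟩
      have hxk : x ∈ F.gr 0 k := by simpa using hx.1
      exact ⟨(hcolon x hxk).2 hx, F.ε_mem _ _ hxk⟩
    · rintro y ⟨hy, hyk⟩
      obtain ⟨x, hx, rfl⟩ := F.exists_ε_eq hM hyk
      exact ⟨x, (hcolon x hx).1 hy, rfl⟩
  · simpa using hreg.bdry_le_colon p 0 (k + 1)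
  · intro x hx
    exact F.ε_mem_linMul_iff b p.2 (by simpa using hx.1)

end GradedFreeResolution
end

/-! ### Generic bases -/

section
variable {K : Type*} [Field K] {V : Type*} [AddCommGroup V] [Module K V]

/-- Over an infinite field, finitely many generic values are attained simultaneously at some
basis: being a basis is itself a generic condition, given by a determinant. -/
lemma exists_basis_of_isGenericValue [Infinite K] {n : ℕ} (e : Module.Basis (Fin n) K V)
    {ι : Type*} [Fintype ι] {f : ι → (Fin n → V) → ℕ} {c : ι → ℕ}
    (h : ∀ p, IsGenericValue e (f p) (c p)) :
    ∃ b : Module.Basis (Fin n) K V, ∀ p, f p b = c p := by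
  choose P hP hf using h
  set D : MvPolynomial (Fin n × Fin n) K := (Matrix.mvPolynomialX (Fin n) (Fin n) K).det
  have hne : D * ∏ p, P p ≠ 0 := mul_ne_zero (Matrix.det_mvPolynomialX_ne_zero (Fin n) K)
    (Finset.prod_ne_zero_iff.2 fun p _ => hP p)
  obtain ⟨x, hx⟩ : ∃ x, MvPolynomial.eval x (D * ∏ p, P p) ≠ 0 := by
    by_contra! hx
    exact hne (MvPolynomial.funext fun x => by rw [hx, map_zero])
  set v : Fin n → V := fun a => ∑ t, x (a, t) • e t
  have hv : (fun s : Fin n × Fin n => e.repr (v s.1) s.2) = x := by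
    funext s
    rw [e.repr_sum_self]
  rw [map_mul, map_prod] at hx
  have hdet : (e.toMatrix v).det ≠ 0 := by
    have h1 := left_ne_zero_of_mul hx
    rw [RingHom.map_det] at h1
    rw [← Matrix.det_transpose]
    convert h1 using 2
    ext a t
    simp [← hv, Module.Basis.toMatrix_apply]
  have hb := (e.is_basis_iff_det (v := v)).2 (by
    rw [Module.Basis.det_apply]
    exact hdet.isUnit)
  refine ⟨Module.Basis.mk hb.1 hb.2.ge, fun p => ?_⟩
  rw [Module.Basis.coe_mk]
  refine hf p v ?_
  rw [hv]
  exact Finset.prod_ne_zero_iff.1 (right_ne_zero_of_mul hx) p (Finset.mem_univ p)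

end

end ExteriorGraded

theorem theorem4p3 {K : Type*} [Field K] [Infinite K]
    {V : Type*} [AddCommGroup V] [Module K V] [Module.Finite K V]
    {n : ℕ} (e : Module.Basis (Fin n) K V)
    {M : Type*} [AddCommGroup M] [Module K M] [Module (ExteriorAlgebra K V) M]
    [Module (ExteriorAlgebra K V)ᵐᵒᵖ M] [IsScalarTower K (ExteriorAlgebra K V) M]
    (ℳ : ℤ → Submodule K M) (hM : ExteriorGraded.IsInCategoryM V ℳ)
    (i k : ℕ) (hi : 1 < i)
    (h : ExteriorGraded.gradedBetti hM.toIsGraded hM.finite i (i + k) =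
      ∑ j : Fin n, (n - (j.val + 1) + i - 1).choose (i - 1) *
        ExteriorGraded.genericAnnNumber hM.finite ℳ e j k) :
    ∀ q : ℕ, 1 ≤ q →
      ExteriorGraded.gradedBetti hM.toIsGraded hM.finite q (q + k) =
        ∑ j : Fin n, (n - (j.val + 1) + q - 1).choose (q - 1) *
          ExteriorGraded.genericAnnNumber hM.finite ℳ e j k := by
  set F := Classical.choice (ExteriorGraded.exists_resolution hM.toIsGraded hM.finite)
  set α : Fin n → ℕ := fun j => ExteriorGraded.genericAnnNumber hM.finite ℳ e j k
  obtain ⟨b, hb⟩ := ExteriorGraded.exists_basis_of_isGenericValue e (c := α) fun j =>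
    Classical.choose_spec (ExteriorGraded.exists_annNumber hM.finite ℳ e j k)
  set a : ℕ → ℕ := fun m => if hm : m < n then α ⟨m, hm⟩ else 0
  have hsum : ∀ q, ∑ j : Fin n, (n - (j.val + 1) + (q + 1) - 1).choose (q + 1 - 1) * α j =
      ExteriorGraded.binomSum a q n := by
    intro q
    rw [ExteriorGraded.binomSum, Finset.sum_range]
    exact Finset.sum_congr rfl fun j _ => by simp [a]
  have hbetti : ∀ q : ℕ,
      ExteriorGraded.gradedBetti hM.toIsGraded hM.finite (q + 1) ((q + 1 : ℕ) + k) =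
        Module.finrank K (ExteriorGraded.cyc F.gr F.dK (F.mulB b) n q (k + q + 1)) -
        Module.finrank K (ExteriorGraded.bdry F.gr F.dK (F.mulB b) n (q + 1) (k + q + 1)) := by
    intro q
    rw [F.finrank_cyc_eq_betti_add b, Nat.add_sub_cancel,
      show ((q + 1 : ℕ) + k : ℤ) = k + q + 1 by push_cast; ring]
    rfl
  have ha : ∀ m < n,
      Module.finrank K (ExteriorGraded.colon F.gr F.dK (F.mulB b) m 0 (k + 1)) =
        a m + Module.finrank K (ExteriorGraded.bdry F.gr F.dK (F.mulB b) (m + 1) 0 k) := by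
    intro m hm
    have := F.finrank_colon_eq_annNumber_add b hM.toIsGraded ⟨m, hm⟩ k
    rwa [hb, show α ⟨m, hm⟩ = a m by simp [a, hm]] at this
  obtain ⟨i, rfl⟩ : ∃ i', i = i' + 1 + 1 := ⟨i - 2, by omega⟩
  rw [hsum, hbetti] at h
  intro q hq
  obtain ⟨q, rfl⟩ : ∃ q', q = q' + 1 := ⟨q - 1, by omega⟩
  rw [hsum, hbetti]
  exact (F.isRegularComplex b).finrank_homology_eq k ha h q
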